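/- **Setting.** Let $d\ge 1$, let $\mathcal Z\subset\mathbb R^d$ be compact with non-empty interior, let $\mu$ be a Borel probability measure with support $\mathcal Z$, and let $f:\mathcal Z\times\mathcal Z\to[0,1]$ be a continuous, symmetric, positive semi-definite kernel. Let $(\lambda_k,u_k)_{k\ge1}$ be a complete system of eigenvalues $\lambda_1\ge\lambda_2\ge\dots\ge0$ and $L_2(\mu)$-orthonormal eigenfunctions of the integral operator $\mathcal A g(x)=\int_{\mathcal Z} f(x,y)g(y)\,\mu(\mathrm dy)$, with the eigenvalue equation holding at every point of $\mathcal Z$ (complete: $\mathcal Ag=0$ for every $g\in L_2(\mu)$ orthogonal to all $u_k$). Let $\phi:\mathcal Z\to\ell_2$, $\phi(x)=[\lambda_1^{1/2}u_1(x),\lambda_2^{1/2}u_2(x),\dots]$, be the Mercer feature map. **Assumptions.** 1. $z^\star$ is an interior point of $\mathcal Z$ and $\phi(z^\star)\ne0$. 2. For all $i,j\in\{1,\dots,d\}$ the mixed partial derivatives $\mathbf H^{ij}_{x,y}=\frac{\partial^2 f}{\partial x^{(i)}\partial y^{(j)}}(x,y)$ exist and are continuous in $(x,y)$ for $x,y$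 in the interior of $\mathcal Z$, and there are finite constants $L_i$ with $|\mathbf H^{ii}_{x,x}-\mathbf H^{ii}_{x,y}|\le L_i\|x-y\|$ for all such $x,y$. Put $d_{\mathrm{loc}}(z^\star)=\operatorname{rank}(\mathbf H_{z^\star,z^\star})$. 3. For some $\epsilon_0>0$ and every $\epsilon\in(0,\epsilon_0)$, $w=w_\epsilon:\mathcal Z\to(0,\infty)$ is continuous with $\int_{\mathcal Z} w\,\mathrm d\mu=1$, and $\mu_w(\mathrm dx)=w(x)\,\mu(\mathrm dx)$. There is a fixed real $d\times d$ matrix $\mathbf\Sigma$ of rank $d$ such that, with $Z\sim\mu_w$, $\mathbb E[(Z-z^\star)(Z-z^\star)^\top]=\epsilon\mathbf\Sigma$ for every $\epsilon\in(0,\epsilon_0)$. 4. With $Z\sim\mu_w$, $\mathbb E[\|Z-z^\star\|^q]=o(\epsilon)$ as $\epsilon\to0$, for $q=5/2$ and $q=3$. **Conclusion.** For $\epsilon\in(0,\epsilon_0)$ the operator $$\mathcal D_w=\mathbb E\big[(\phi(Z)-\phi(z^\star))(\phi(Z)-\phi(z^\star))^\top\big],\qquad Z\sim\mu_w,$$ on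 $\ell_2$ is well defined (the integrand is Bochner integrable in operator norm), and its eigenvalues $\lambda_1(\mathcal D_w)\ge\lambda_2(\mathcal D_w)\ge\dots$, counted with multiplicity and continued by zeros if only finitely many are non-zero, are summable. As $\epsilon\to0$, $$\lambda_i(\mathcal D_w)=\Theta(\epsilon)\quad\text{for } i=1,\dots,d_{\mathrm{loc}}(z^\star),\qquad\text{and}\qquad \sum_{i>d_{\mathrm{loc}}(z^\star)}\lambda_i(\mathcal D_w)=o(\epsilon).$$ -/

import Mathlib

open Filter Topology MeasureTheory Asymptotics

namespace LASE

/-- The Hilbert space `ℓ₂` of real square-summable sequences. -/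
abbrev Ell2 : Type := lp (fun _ : ℕ => ℝ) 2

/-- The latent position model: a compact latent space `Z`, here inside `ℝ^d`, a Borel probability
measure `μ` with support `Z`, and a continuous, symmetric, positive semi-definite kernel
`f : Z × Z → [0,1]`. Functions on `Z` are written as functions on `ℝ^d` whose values outside `Z`
play no role. -/
structure IsLatentPositionModel {d : ℕ} (Z : Set (EuclideanSpace ℝ (Fin d)))
    (μ : Measure (EuclideanSpace ℝ (Fin d)))
    (f : EuclideanSpace ℝ (Fin d) → EuclideanSpace ℝ (Fin d) → ℝ) : Prop where
  isCompact : IsCompact Z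
  isProbabilityMeasure : IsProbabilityMeasure μ
  support_eq : μ.support = Z
  continuousOn : ContinuousOn (fun p : EuclideanSpace ℝ (Fin d) × EuclideanSpace ℝ (Fin d) =>
    f p.1 p.2) (Z ×ˢ Z)
  mem_Icc : ∀ x ∈ Z, ∀ y ∈ Z, f x y ∈ Set.Icc (0 : ℝ) 1
  symm : ∀ x ∈ Z, ∀ y ∈ Z, f x y = f y x
  posSemidef : ∀ (n : ℕ) (x : Fin n → EuclideanSpace ℝ (Fin d)) (c : Fin n → ℝ),
    (∀ i, x i ∈ Z) → 0 ≤ ∑ i, ∑ j, c i * c j * f (x i) (x j)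

/-- `(u k, lam k)` is a full ordered system of eigenfunctions and eigenvalues of the integral
operator `g ↦ ∫ f(·,y) g(y) μ(dy)` on `L₂(μ)`: the `u k` are orthonormal in `L₂(μ)`, the `lam k`
are nonnegative and non-increasing, the eigenvalue equation holds at every point of `Z` (so an
eigenfunction with nonzero eigenvalue is the continuous representative of its class), and every
`g` orthogonal to all the `u k` is annihilated by the operator (so no eigenpair with nonzero
eigenvalue is missing). -/
structure IsMercerSystem {d : ℕ} (Z : Set (EuclideanSpace ℝ (Fin d)))
    (μ : Measure (EuclideanSpace ℝ (Fin d)))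
    (f : EuclideanSpace ℝ (Fin d) → EuclideanSpace ℝ (Fin d) → ℝ)
    (lam : ℕ → ℝ) (u : ℕ → EuclideanSpace ℝ (Fin d) → ℝ) : Prop where
  antitone : Antitone lam
  nonneg : ∀ k, 0 ≤ lam k
  memLp : ∀ k, MemLp (u k) 2 μ
  orthonormal : ∀ k l, ∫ x, u k x * u l x ∂μ = if k = l then 1 else 0
  eigen : ∀ k, ∀ x ∈ Z, ∫ y, f x y * u k y ∂μ = lam k * u k x
  complete : ∀ g : EuclideanSpace ℝ (Fin d) → ℝ, MemLp g 2 μ →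
    (∀ k, ∫ x, u k x * g x ∂μ = 0) → ∀ᵐ x ∂μ, ∫ y, f x y * g y ∂μ = 0

open Classical in
/-- The Mercer feature map `φ(x) = [λ₁^{1/2} u₁(x), λ₂^{1/2} u₂(x), …] ∈ ℓ₂` (with the value `0`
at points where this sequence is not square-summable; there are no such points in `Z`). -/
noncomputable def mercerFeatureMap {d : ℕ} (lam : ℕ → ℝ)
    (u : ℕ → EuclideanSpace ℝ (Fin d) → ℝ) (x : EuclideanSpace ℝ (Fin d)) : Ell2 :=
  if h : Memℓp (fun k : ℕ => Real.sqrt (lam k) * u k x) 2 then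
    ⟨fun k : ℕ => Real.sqrt (lam k) * u k x, h⟩
  else 0

/-- The first partial derivative `∂f/∂y^{(j)}` at `(x, y)`. -/
noncomputable def partialSnd {d : ℕ}
    (f : EuclideanSpace ℝ (Fin d) → EuclideanSpace ℝ (Fin d) → ℝ) (j : Fin d)
    (x y : EuclideanSpace ℝ (Fin d)) : ℝ :=
  lineDeriv ℝ (fun y' => f x y') y (EuclideanSpace.single j 1)

/-- The matrix `H_{x,y}` of mixed second derivatives `∂²f/∂x^{(i)}∂y^{(j)}` at `(x, y)`. -/
noncomputable def mixedHessian {d : ℕ}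
    (f : EuclideanSpace ℝ (Fin d) → EuclideanSpace ℝ (Fin d) → ℝ)
    (x y : EuclideanSpace ℝ (Fin d)) : Matrix (Fin d) (Fin d) ℝ :=
  Matrix.of fun i j =>
    lineDeriv ℝ (fun x' => partialSnd f j x' y) x (EuclideanSpace.single i 1)

/-- The smoothness assumption on the kernel: in the interior of `Z` all mixed second derivatives
`∂²f/∂x^{(i)}∂y^{(j)}` exist and are continuous in `(x, y)`, and the diagonal ones satisfy
`|H^{ii}_{x,x} - H^{ii}_{x,y}| ≤ L_i ‖x - y‖`. -/
structure HasLipschitzMixedDerivatives {d : ℕ} (Z : Set (EuclideanSpace ℝ (Fin d)))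
    (f : EuclideanSpace ℝ (Fin d) → EuclideanSpace ℝ (Fin d) → ℝ) : Prop where
  differentiable_snd : ∀ j, ∀ x ∈ interior Z, ∀ y ∈ interior Z,
    LineDifferentiableAt ℝ (fun y' => f x y') y (EuclideanSpace.single j 1)
  differentiable_fst : ∀ i j, ∀ x ∈ interior Z, ∀ y ∈ interior Z,
    LineDifferentiableAt ℝ (fun x' => partialSnd f j x' y) x (EuclideanSpace.single i 1)
  continuousOn : ∀ i j, ContinuousOn
    (fun p : EuclideanSpace ℝ (Fin d) × EuclideanSpace ℝ (Fin d) => mixedHessian f p.1 p.2 i j)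
    (interior Z ×ˢ interior Z)
  lipschitz : ∃ L : Fin d → ℝ, ∀ i, ∀ x ∈ interior Z, ∀ y ∈ interior Z,
    |mixedHessian f x x i i - mixedHessian f x y i i| ≤ L i * ‖x - y‖

/-- The local latent dimension at `z`: the rank of `H_{z,z}`. -/
noncomputable def localDim {d : ℕ}
    (f : EuclideanSpace ℝ (Fin d) → EuclideanSpace ℝ (Fin d) → ℝ)
    (z : EuclideanSpace ℝ (Fin d)) : ℕ :=
  (mixedHessian f z z).rank

/-- The reweighted measure `μ_w(dx) = w(x) μ(dx)`. -/
noncomputable def weightedMeasure {d : ℕ} (μ : Measure (EuclideanSpace ℝ (Fin d)))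
    (w : EuclideanSpace ℝ (Fin d) → ℝ) : Measure (EuclideanSpace ℝ (Fin d)) :=
  μ.withDensity fun x => ENNReal.ofReal (w x)

/-- The rank-one operator `(φ(x) - φ(z)) (φ(x) - φ(z))ᵀ` on `ℓ₂`. -/
noncomputable def increment {d : ℕ} (φ : EuclideanSpace ℝ (Fin d) → Ell2)
    (z x : EuclideanSpace ℝ (Fin d)) : Ell2 →L[ℝ] Ell2 :=
  InnerProductSpace.rankOne ℝ (φ x - φ z) (φ x - φ z)

/-- The operator `D = E[(φ(X) - φ(z)) (φ(X) - φ(z))ᵀ]` on `ℓ₂`, where `X ∼ ν`. -/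
noncomputable def centredSecondMoment {d : ℕ} (φ : EuclideanSpace ℝ (Fin d) → Ell2)
    (z : EuclideanSpace ℝ (Fin d)) (ν : Measure (EuclideanSpace ℝ (Fin d))) :
    Ell2 →L[ℝ] Ell2 :=
  ∫ x, increment φ z x ∂ν

/-- The `(i+1)`-th largest eigenvalue, counted with multiplicity, of a compact positive operator
`T` on an infinite-dimensional Hilbert space: the largest `a` such that `T` has `i + 1` orthonormal
eigenvectors with eigenvalues at least `a`. (If `T` has only finitely many nonzero eigenvalues, the
list is continued by zeros.) -/
noncomputable def eigenvalue {E : Type*} [NormedAddCommGroup E] [InnerProductSpace ℝ E]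
    (T : E →L[ℝ] E) (i : ℕ) : ℝ :=
  sSup {a : ℝ | ∃ v : Fin (i + 1) → E, Orthonormal ℝ v ∧
    ∀ j, ∃ b : ℝ, a ≤ b ∧ T (v j) = b • v j}

end LASE

namespace LASE

open scoped InnerProductSpace

/-! ### Courant–Fischer bounds for compact positive operators -/

section Operators

variable {E : Type*} [NormedAddCommGroup E] [InnerProductSpace ℝ E]

/-! By Mercer's theorem, valid at every pair of points of `Z`, the feature map `φ` has Gram kernel
`f`. Hence inner products of increments of `φ` are double differences of `f`, and continuity of the
mixed second derivatives makes `φ` Fréchet differentiable at `z`, with partial derivatives `J i`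
whose Gram matrix is `H_{z,z}`. So `Q = span J` has dimension equal to the local dimension.

Write `φ(x) - φ(z)` as the linear part `∑ (x i - z i) J i` plus a remainder `R`. Near `z`, `‖R‖²` is
a small multiple of `‖x - z‖²`, whose mean is `ε tr Σ`; away from `z`, `R` is bounded and the third
moment takes over. Thus `E‖R‖² = o(ε)` (`integral_linearRemainder_isLittleO`).

On `Qᗮ` only `R` is seen, so the trace of `D` there is at most `E‖R‖²`, which bounds the tail of the
spectrum (`sum_eigenvalue_le`). On `Q` the linear part has quadratic form at least `c ε ‖v‖²`, since
`Σ` is positive definite; subtracting the remainder leaves order `ε`, and `le_eigenvalue` bounds the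
leading eigenvalues below. The upper bound is `E‖φ(Z) - φ(z)‖² = O(ε)`.

Eigenvalues are defined through eigenvectors. Upper bounds follow directly from Rayleigh quotients,
but lower bounds need the existence of eigenvectors, obtained from compactness by deflation. -/

theorem le_of_orthonormal_eigenvectors {T : E →L[ℝ] E} {C : ℝ}
    (hC : ∀ x : E, ‖x‖ = 1 → ⟪T x, x⟫_ℝ ≤ C) {i : ℕ} {a : ℝ}
    (ha : ∃ v : Fin (i + 1) → E, Orthonormal ℝ v ∧ ∀ j, ∃ b : ℝ, a ≤ b ∧ T (v j) = b • v j) :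
    a ≤ C := by
  obtain ⟨v, hv, hb⟩ := ha
  obtain ⟨b, hab, hTb⟩ := hb 0
  have h := hC (v 0) (hv.1 0)
  rw [hTb, real_inner_smul_left, real_inner_self_eq_norm_sq, hv.1 0] at h
  linarith

theorem inner_apply_self_le_opNorm (T : E →L[ℝ] E) (x : E) (hx : ‖x‖ = 1) :
    ⟪T x, x⟫_ℝ ≤ ‖T‖ := by
  have h1 := real_inner_le_norm (T x) x
  have h2 := T.le_opNorm x
  rw [hx, mul_one] at h1 h2
  exact h1.trans h2

theorem bddAbove_eigenvalue (T : E →L[ℝ] E) (i : ℕ) :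
    BddAbove {a : ℝ | ∃ v : Fin (i + 1) → E, Orthonormal ℝ v ∧
      ∀ j, ∃ b : ℝ, a ≤ b ∧ T (v j) = b • v j} :=
  ⟨‖T‖, fun _ ha => le_of_orthonormal_eigenvectors (inner_apply_self_le_opNorm T) ha⟩

theorem eigenvalue_nonneg {T : E →L[ℝ] E} (hT : T.IsPositive) (i : ℕ) : 0 ≤ eigenvalue T i := by
  rcases Set.eq_empty_or_nonempty {a : ℝ | ∃ v : Fin (i + 1) → E, Orthonormal ℝ v ∧
      ∀ j, ∃ b : ℝ, a ≤ b ∧ T (v j) = b • v j} with h | ⟨a, v, hv, hb⟩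
  · rw [eigenvalue, h, Real.sSup_empty]
  · refine le_csSup (bddAbove_eigenvalue T i) ⟨v, hv, fun j => ?_⟩
    obtain ⟨b, -, hTb⟩ := hb j
    refine ⟨b, ?_, hTb⟩
    have h := hT.inner_nonneg_left (v j)
    rwa [hTb, real_inner_smul_left, real_inner_self_eq_norm_sq, hv.1 j, one_pow, mul_one] at h

theorem eigenvalue_le {T : E →L[ℝ] E} {C : ℝ} (hC₀ : 0 ≤ C)
    (hC : ∀ x : E, ‖x‖ = 1 → ⟪T x, x⟫_ℝ ≤ C) (i : ℕ) : eigenvalue T i ≤ C :=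
  Real.sSup_le (fun _ ha => le_of_orthonormal_eigenvectors hC ha) hC₀

/-- A subspace of dimension `n` on which a Rayleigh quotient is at least `c`. -/
theorem exists_submodule_of_orthonormal_eigenvectors {T : E →L[ℝ] E} {n : ℕ} {c : ℝ}
    {v : Fin n → E} (hv : Orthonormal ℝ v) (hb : ∀ j, ∃ b : ℝ, c ≤ b ∧ T (v j) = b • v j) :
    ∃ W : Submodule ℝ E, Module.finrank ℝ W = n ∧ FiniteDimensional ℝ W ∧
      ∀ x ∈ W, c * ‖x‖ ^ 2 ≤ ⟪T x, x⟫_ℝ := by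
  refine ⟨Submodule.span ℝ (Set.range v), ?_, FiniteDimensional.span_of_finite ℝ
    (Set.finite_range v), fun x hx => ?_⟩
  · simpa using finrank_span_eq_card hv.linearIndependent
  · choose b hcb hTb using hb
    obtain ⟨a, rfl⟩ := (Submodule.mem_span_range_iff_exists_fun ℝ).1 hx
    rw [← real_inner_self_eq_norm_sq, map_sum]
    simp only [map_smul, hTb]
    have h1 : ⟪∑ j, a j • v j, ∑ j, a j • v j⟫_ℝ = ∑ j, a j * a j := by
      simpa using hv.inner_sum a a Finset.univ
    have h2 : ⟪∑ j, a j • b j • v j, ∑ j, a j • v j⟫_ℝ = ∑ j, (a j * b j) * a j := by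
      simpa [smul_smul] using hv.inner_sum (fun j => a j * b j) a Finset.univ
    rw [h1, h2, Finset.mul_sum]
    refine Finset.sum_le_sum fun j _ => ?_
    nlinarith [hcb j, mul_self_nonneg (a j)]

theorem exists_submodule_finrank_eq (hE : ¬ FiniteDimensional ℝ E) (n : ℕ) :
    ∃ W : Submodule ℝ E, Module.finrank ℝ W = n ∧ FiniteDimensional ℝ W := by
  have h : (n : Cardinal) ≤ Module.rank ℝ E := by
    refine (Cardinal.natCast_lt_aleph0).le.trans ?_
    exact not_lt.1 fun h => hE (Module.rank_lt_aleph0_iff.1 h)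
  obtain ⟨s, hs, hli⟩ := le_rank_iff_exists_linearIndependent_finset.1 h
  refine ⟨Submodule.span ℝ (s : Set E), ?_, FiniteDimensional.span_finset ℝ s⟩
  rw [finrank_span_finset_eq_card hli, hs]

theorem exists_submodule_of_lt_eigenvalue (hE : ¬ FiniteDimensional ℝ E) {T : E →L[ℝ] E}
    (hT : T.IsPositive) {i : ℕ} {c : ℝ} (hc : c < eigenvalue T i) :
    ∃ W : Submodule ℝ E, Module.finrank ℝ W = i + 1 ∧ FiniteDimensional ℝ W ∧
      ∀ x ∈ W, c * ‖x‖ ^ 2 ≤ ⟪T x, x⟫_ℝ := by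
  -- For negative `c` positivity makes any subspace work. This covers the default value 0 of the
  -- supremum when eigenvectors are lacking.
  rcases lt_or_ge c 0 with h0 | h0
  · obtain ⟨W, hW, hfin⟩ := exists_submodule_finrank_eq hE (i + 1)
    refine ⟨W, hW, hfin, fun x _ => (mul_nonpos_of_nonpos_of_nonneg h0.le (sq_nonneg _)).trans ?_⟩
    exact hT.inner_nonneg_left x
  · have hne : {a : ℝ | ∃ v : Fin (i + 1) → E, Orthonormal ℝ v ∧
        ∀ j, ∃ b : ℝ, a ≤ b ∧ T (v j) = b • v j}.Nonempty := by
      by_contra hemp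
      rw [eigenvalue, Set.not_nonempty_iff_eq_empty.1 hemp, Real.sSup_empty] at hc
      linarith
    obtain ⟨a, ⟨v, hv, hb⟩, hca⟩ := exists_lt_of_lt_csSup hne hc
    exact exists_submodule_of_orthonormal_eigenvectors hv fun j =>
      (hb j).imp fun b hb => ⟨hca.le.trans hb.1, hb.2⟩

/-- Dimension count: the orthogonal projection onto `Q`, restricted to `W`, has a nonzero kernel. -/
theorem exists_unit_mem_orthogonal (W Q : Submodule ℝ E) [FiniteDimensional ℝ W]
    [FiniteDimensional ℝ Q] (h : Module.finrank ℝ Q < Module.finrank ℝ W) :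
    ∃ x ∈ W, x ∈ Qᗮ ∧ ‖x‖ = 1 := by
  have hker := LinearMap.ker_ne_bot_of_finrank_lt
    (f := (Q.orthogonalProjectionOnto : E →ₗ[ℝ] Q) ∘ₗ W.subtype) h
  obtain ⟨x, hx, hx0⟩ := Submodule.exists_mem_ne_zero_of_ne_bot hker
  have hx0' : (x : E) ≠ 0 := by simpa using hx0
  have hxQ : (x : E) ∈ Qᗮ := by
    rw [← Submodule.orthogonalProjectionOnto_eq_zero_iff]
    simpa using hx
  exact ⟨‖(x : E)‖⁻¹ • (x : E), W.smul_mem _ x.2, Qᗮ.smul_mem _ hxQ,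
    norm_smul_inv_norm (𝕜 := ℝ) hx0'⟩

/-- Beyond any `r`-dimensional subspace `Q`, the eigenvalues with indices `r, r + 1, …` are nearly
dominated by the Rayleigh quotients of orthonormal vectors orthogonal to `Q`. -/
theorem exists_orthonormal_of_eigenvalue (hE : ¬ FiniteDimensional ℝ E) {T : E →L[ℝ] E}
    (hT : T.IsPositive) {δ : ℝ} (hδ : 0 < δ) (N : ℕ) :
    ∀ (r : ℕ) (Q : Submodule ℝ E) [FiniteDimensional ℝ Q], Module.finrank ℝ Q ≤ r →
    ∃ v : Fin N → E, Orthonormal ℝ v ∧ (∀ j, v j ∈ Qᗮ) ∧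
      ∀ j : Fin N, eigenvalue T (r + j) - δ ≤ ⟪T (v j), v j⟫_ℝ := by
  induction N with
  | zero =>
    intro r Q _ _
    exact ⟨Fin.elim0, ⟨fun j => j.elim0, fun j => j.elim0⟩, fun j => j.elim0, fun j => j.elim0⟩
  | succ N ih =>
    intro r Q _ hQ
    obtain ⟨W, hW, hfin, hWT⟩ :=
      exists_submodule_of_lt_eigenvalue hE hT (sub_lt_self (eigenvalue T r) hδ)
    -- Greedy choice: `W` has dimension `r + 1`, more than `Q`. Adding `x` to `Q` then raises both
    -- the dimension bound and the eigenvalue index by one.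
    obtain ⟨x, hxW, hxQ, hx⟩ := exists_unit_mem_orthogonal W Q (by omega)
    have hfr : Module.finrank ℝ ↥(Q ⊔ Submodule.span ℝ {x}) ≤ r + 1 := by
      have h1 := Submodule.finrank_add_le_finrank_add_finrank Q (Submodule.span ℝ {x})
      have h2 := finrank_span_le_card (R := ℝ) ({x} : Set E)
      simp only [Set.toFinset_singleton, Finset.card_singleton] at h2
      omega
    obtain ⟨v, hv, hvQ, hvT⟩ := ih (r + 1) (Q ⊔ Submodule.span ℝ {x}) hfr
    refine ⟨Matrix.vecCons x v, orthonormal_vecCons_iff.2 ⟨hx, fun j => ?_, hv⟩, fun j => ?_,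
      fun j => ?_⟩
    · exact (hvQ j) x (Submodule.mem_sup_right (Submodule.mem_span_singleton_self x))
    · refine Fin.cases ?_ (fun j => ?_) j
      · exact hxQ
      · exact Submodule.orthogonal_le le_sup_left (hvQ j)
    · refine Fin.cases ?_ (fun j => ?_) j
      · have := hWT x hxW
        rw [hx, one_pow, mul_one] at this
        simpa using this
      · have := hvT j
        simp only [Matrix.cons_val_succ, Fin.val_succ]
        rwa [show r + (j + 1 : ℕ) = r + 1 + j by ring]

/-- A Ky Fan type inequality: the trace of `T` on `Qᗮ` controls all eigenvalues from index `r` on.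
-/
theorem sum_eigenvalue_le (hE : ¬ FiniteDimensional ℝ E) {T : E →L[ℝ] E}
    (hT : T.IsPositive) {r : ℕ} (Q : Submodule ℝ E) [FiniteDimensional ℝ Q]
    (hQ : Module.finrank ℝ Q ≤ r) {C : ℝ}
    (hC : ∀ (N : ℕ) (v : Fin N → E), Orthonormal ℝ v → (∀ j, v j ∈ Qᗮ) →
      ∑ j, ⟪T (v j), v j⟫_ℝ ≤ C) (N : ℕ) :
    ∑ j ∈ Finset.range N, eigenvalue T (r + j) ≤ C := by
  refine le_of_forall_pos_le_add fun η hη => ?_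
  -- The `N` losses add up to at most `η`; `N + 1` avoids dividing by zero.
  obtain ⟨v, hv, hvQ, hvT⟩ := exists_orthonormal_of_eigenvalue hE hT
    (δ := η / (N + 1)) (by positivity) N r Q hQ
  have h1 := hC N v hv hvQ
  have h2 : ∑ j : Fin N, (eigenvalue T (r + j) - η / (N + 1)) ≤ ∑ j, ⟪T (v j), v j⟫_ℝ :=
    Finset.sum_le_sum fun j _ => hvT j
  rw [Finset.sum_sub_distrib, Fin.sum_univ_eq_sum_range (fun j => eigenvalue T (r + j)) N] at h2
  simp only [Finset.sum_const, Finset.card_univ, Fintype.card_fin, nsmul_eq_mul] at h2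
  have h3 : (N : ℝ) * (η / (N + 1)) ≤ η := by
    rw [mul_div_assoc', div_le_iff₀ (by positivity)]
    nlinarith
  linarith

/-- By the Fredholm alternative the nonzero number `‖T‖` is an eigenvalue or lies in the resolvent
set. The latter would keep Rayleigh quotients a fixed distance below `‖T‖`, which is their supremum.
-/
theorem exists_eigenvector_opNorm [CompleteSpace E] {T : E →L[ℝ] E}
    (hT : T.IsPositive) (hcpt : IsCompactOperator T) {c : ℝ} (hc : 0 < c) {w : E} (hw : w ≠ 0)
    (hcw : c * ‖w‖ ^ 2 ≤ ⟪T w, w⟫_ℝ) :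
    ∃ x : E, ‖x‖ = 1 ∧ T x = ‖T‖ • x ∧ c ≤ ‖T‖ := by
  have hw' : 0 < ‖w‖ := norm_pos_iff.2 hw
  have hcT : c ≤ ‖T‖ := by
    have h1 := (real_inner_le_norm (T w) w).trans
      (mul_le_mul_of_nonneg_right (T.le_opNorm w) (norm_nonneg w))
    have h2 : c * ‖w‖ ^ 2 ≤ ‖T‖ * ‖w‖ ^ 2 := by nlinarith
    exact le_of_mul_le_mul_right h2 (by positivity)
  have : Nontrivial E := ⟨w, 0, hw⟩
  have hT0 : ‖T‖ ≠ 0 := (hc.trans_le hcT).ne'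
  have heig : Module.End.HasEigenvalue (T : E →ₗ[ℝ] E) ‖T‖ := by
    refine (hcpt.hasEigenvalue_or_mem_resolventSet hT0).resolve_right fun hres => ?_
    obtain ⟨ε, hε, h⟩ := T.rayleighQuotient_le_of_norm_mem_resolventSet (by simpa using hres)
    have hle : ‖T‖ ≤ ‖T‖ - ε := by
      conv_lhs => rw [T.norm_eq_iSup_rayleighQuotient hT.isSymmetric]
      refine ciSup_le fun x => ?_
      rw [abs_of_nonneg]
      · exact h x
      · exact div_nonneg (hT.2 x) (sq_nonneg _)
    linarith
  obtain ⟨x, hx⟩ := heig.exists_hasEigenvector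
  have hTx : T x = ‖T‖ • x := hx.apply_eq_smul
  refine ⟨‖x‖⁻¹ • x, norm_smul_inv_norm (𝕜 := ℝ) hx.2, ?_, hcT⟩
  rw [map_smul, hTx, smul_comm]

/-- Deflation: compress `T` to the complement of the eigenvectors already found. While `W` has
larger dimension it meets that complement, so the compression still has norm at least `c`. -/
theorem exists_orthonormal_eigenvectors [CompleteSpace E] {T : E →L[ℝ] E}
    (hT : T.IsPositive) (hcpt : IsCompactOperator T) {c : ℝ} (hc : 0 < c) (W : Submodule ℝ E)
    [FiniteDimensional ℝ W] (hW : ∀ x ∈ W, c * ‖x‖ ^ 2 ≤ ⟪T x, x⟫_ℝ) (n : ℕ)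
    (hn : n ≤ Module.finrank ℝ W) :
    ∃ v : Fin n → E, Orthonormal ℝ v ∧ ∀ j, ∃ b : ℝ, c ≤ b ∧ T (v j) = b • v j := by
  induction n with
  | zero => exact ⟨Fin.elim0, ⟨fun j => j.elim0, fun j => j.elim0⟩, fun j => j.elim0⟩
  | succ n ih =>
    obtain ⟨v, hv, hb⟩ := ih (by omega)
    set Q := Submodule.span ℝ (Set.range v) with hQ
    have : FiniteDimensional ℝ Q := FiniteDimensional.span_of_finite ℝ (Set.finite_range v)
    have hvQ : ∀ j, v j ∈ Q := fun j => Submodule.subset_span ⟨j, rfl⟩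
    have hQn : Module.finrank ℝ Q = n := by
      simpa using finrank_span_eq_card hv.linearIndependent
    obtain ⟨y, hyW, hyQ, hy⟩ := exists_unit_mem_orthogonal W Q (by omega)
    have hPy : Qᗮ.starProjection y = y := Submodule.starProjection_eq_self_iff.2 hyQ
    obtain ⟨x, hx, hTx, hcM⟩ := exists_eigenvector_opNorm (hT.conj_starProjection Qᗮ)
      ((hcpt.comp_clm Qᗮ.starProjection).clm_comp Qᗮ.starProjection) hc (w := y)
      (by rintro rfl; simp at hy) (by
        have h := hW y hyW
        simp only [ContinuousLinearMap.comp_apply, hPy]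
        rwa [Submodule.inner_starProjection_left_eq_right, hPy])
    set M := ‖Qᗮ.starProjection ∘L T ∘L Qᗮ.starProjection‖
    have hM : M ≠ 0 := (hc.trans_le hcM).ne'
    -- An eigenvector of the compression with nonzero eigenvalue lies in its range.
    have hxQ : x ∈ Qᗮ := by
      rw [← inv_smul_smul₀ hM x, ← hTx]
      exact Qᗮ.smul_mem _ (Submodule.starProjection_apply_mem _ _)
    have hPx : Qᗮ.starProjection x = x := Submodule.starProjection_eq_self_iff.2 hxQ
    -- Since `T` is symmetric and `Q` is spanned by eigenvectors, `T` preserves `Qᗮ`; hence `x` is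
    -- an eigenvector of `T` itself.
    have hTxQ : T x ∈ Qᗮ := by
      rw [hQ, Submodule.mem_orthogonal]
      intro u hu
      induction hu using Submodule.span_induction with
      | mem u hu =>
        obtain ⟨j, rfl⟩ := hu
        obtain ⟨b, -, hTb⟩ := hb j
        have h1 : ⟪T (v j), x⟫_ℝ = ⟪v j, T x⟫_ℝ := hT.isSymmetric (v j) x
        rw [← h1, hTb, real_inner_smul_left, hxQ (v j) (hvQ j), mul_zero]
      | zero => simp
      | add a b _ _ ha hb => rw [inner_add_left, ha, hb, add_zero]
      | smul a b _ hb => rw [real_inner_smul_left, hb, mul_zero]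
    have hTx' : T x = M • x := by
      simp only [ContinuousLinearMap.comp_apply, hPx] at hTx
      rwa [Submodule.starProjection_eq_self_iff.2 hTxQ] at hTx
    refine ⟨Matrix.vecCons x v, orthonormal_vecCons_iff.2 ⟨hx, fun j => ?_, hv⟩, fun j => ?_⟩
    · rw [real_inner_comm]
      exact hxQ (v j) (hvQ j)
    · refine Fin.cases ?_ (fun j => ?_) j
      · exact ⟨M, hcM, hTx'⟩
      · exact hb j

theorem le_eigenvalue [CompleteSpace E] {T : E →L[ℝ] E}
    (hT : T.IsPositive) (hcpt : IsCompactOperator T) {c : ℝ} (hc : 0 < c) (W : Submodule ℝ E)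
    [FiniteDimensional ℝ W] (hW : ∀ x ∈ W, c * ‖x‖ ^ 2 ≤ ⟪T x, x⟫_ℝ) {i : ℕ}
    (hi : i < Module.finrank ℝ W) : c ≤ eigenvalue T i :=
  le_csSup (bddAbove_eigenvalue T i) (exists_orthonormal_eigenvectors hT hcpt hc W hW (i + 1) hi)

end Operators

/-! ### Feature maps of positive semidefinite kernels -/

section Kernel

universe v

/-- Moore–Aronszajn: a symmetric positive semidefinite kernel on `Z` is the Gram kernel of a map
into a Hilbert space in which the image of `Z` is total. -/
theorem exists_total_feature_map {α : Type v} (Z : Set α) (f : α → α → ℝ)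
    (hsymm : ∀ x ∈ Z, ∀ y ∈ Z, f x y = f y x)
    (hpsd : ∀ (n : ℕ) (x : Fin n → α) (c : Fin n → ℝ), (∀ i, x i ∈ Z) →
      0 ≤ ∑ i, ∑ j, c i * c j * f (x i) (x j)) :
    ∃ (H : Type v) (_ : NormedAddCommGroup H) (_ : InnerProductSpace ℝ H) (_ : CompleteSpace H)
      (k : α → H), (∀ x ∈ Z, ∀ y ∈ Z, ⟪k x, k y⟫_ℝ = f x y) ∧
        ∀ h : H, (∀ x ∈ Z, ⟪h, k x⟫_ℝ = 0) → h = 0 := by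
  classical
  -- Scalars are encoded as operators on `ℝ`, to fit the operator-valued form of reproducing
  -- kernels.
  let K : Matrix Z Z (ℝ →L[ℝ] ℝ) :=
    Matrix.of fun x y => f x y • ContinuousLinearMap.id ℝ ℝ
  have hK : K.PosSemidef := by
    suffices h : K.IsHermitian ∧ ∀ vv : Z →₀ ℝ,
        0 ≤ RCLike.re (vv.sum fun x w => vv.sum fun x' w' => ⟪K x' x w, w'⟫_ℝ) from
      (RKHS.posSemidef_tfae.out 0 2).2 h
    refine ⟨?_, fun vv => ?_⟩
    · ext x y
      simp [K, hsymm x x.2 y y.2, ContinuousLinearMap.star_eq_adjoint,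
        ContinuousLinearMap.adjoint_id]
    · have h := hpsd vv.support.card (fun i => (vv.support.equivFin.symm i : Z))
        (fun i => vv (vv.support.equivFin.symm i : Z)) (fun i => Subtype.coe_prop _)
      refine h.trans_eq ?_
      simp only [Finsupp.sum, RCLike.re_to_real]
      rw [← Finset.sum_coe_sort vv.support]
      refine (Fintype.sum_equiv vv.support.equivFin _ _ fun x => ?_).symm
      rw [← Finset.sum_coe_sort vv.support]
      refine Fintype.sum_equiv vv.support.equivFin _ _ fun y => ?_
      simp only [Equiv.symm_apply_apply, K, Matrix.of_apply]
      simp [hsymm _ y.1.2 _ x.1.2]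
      ring
  have : Fact K.PosSemidef := ⟨hK⟩
  refine ⟨RKHS.OfKernel K, inferInstance, inferInstance, inferInstance,
    fun x => if hx : x ∈ Z then RKHS.kerFun (RKHS.OfKernel K) ⟨x, hx⟩ 1 else 0,
    fun x hx y hy => ?_, fun h hh => ?_⟩
  · simp only [dif_pos hx, dif_pos hy]
    rw [← RKHS.kernel_inner, RKHS.OfKernel.kernel_ofKernel]
    simp [K, hsymm x hx y hy]
  -- Pairing with `kerFun` is evaluation, so a vector orthogonal to all features is the zero
  -- function.
  · refine RKHS.ext fun x => ?_
    have := hh x x.2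
    simp only [dif_pos x.2] at this
    rw [RKHS.inner_kerFun] at this
    simpa using this

/-- The identity `‖k y - k x‖² = f y y - 2 f y x + f x x` transfers continuity from `f` to `k`. -/
theorem continuousOn_of_continuousOn_inner {α H : Type*} [TopologicalSpace α]
    [NormedAddCommGroup H] [InnerProductSpace ℝ H] {Z : Set α} {f : α → α → ℝ} {k : α → H}
    (hk : ∀ x ∈ Z, ∀ y ∈ Z, ⟪k x, k y⟫_ℝ = f x y)
    (hf : ContinuousOn (fun p : α × α => f p.1 p.2) (Z ×ˢ Z)) : ContinuousOn k Z := by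
  intro x hx
  have h1 : ContinuousOn (fun y => f y y - 2 * f y x + f x x) Z := by
    have ha : ContinuousOn (fun y => f y y) Z :=
      hf.comp (f := fun y => (y, y)) (by fun_prop) fun y hy => ⟨hy, hy⟩
    have hb : ContinuousOn (fun y => f y x) Z :=
      hf.comp (f := fun y => (y, x)) (by fun_prop) fun y hy => ⟨hy, hx⟩
    exact (ha.sub (continuousOn_const.mul hb)).add continuousOn_const
  have h2 : Tendsto (fun y => √(f y y - 2 * f y x + f x x)) (𝓝[Z] x) (𝓝 0) := by
    have := (h1 x hx).sqrt
    simpa [ContinuousWithinAt, two_mul] using this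
  refine tendsto_iff_norm_sub_tendsto_zero.2 (h2.congr' ?_)
  filter_upwards [self_mem_nhdsWithin] with y hy
  rw [← hk y hy y hy, ← hk y hy x hx, ← hk x hx x hx, real_inner_self_eq_norm_sq,
    real_inner_self_eq_norm_sq, ← norm_sub_sq_real, Real.sqrt_sq (norm_nonneg _)]

end Kernel

/-! ### Pointwise Mercer expansion -/

section Mercer

variable {d : ℕ} {Z : Set (EuclideanSpace ℝ (Fin d))} {μ : Measure (EuclideanSpace ℝ (Fin d))}
  {f : EuclideanSpace ℝ (Fin d) → EuclideanSpace ℝ (Fin d) → ℝ} {lam : ℕ → ℝ}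
  {u : ℕ → EuclideanSpace ℝ (Fin d) → ℝ}

theorem IsLatentPositionModel.ae_mem (h : IsLatentPositionModel Z μ f) : ∀ᵐ x ∂μ, x ∈ Z := by
  have := Measure.measure_compl_support (μ := μ)
  rwa [h.support_eq] at this

theorem IsLatentPositionModel.aestronglyMeasurable (h : IsLatentPositionModel Z μ f)
    {F : Type*} [TopologicalSpace F] [TopologicalSpace.PseudoMetrizableSpace F]
    {g : EuclideanSpace ℝ (Fin d) → F} (hg : ContinuousOn g Z) : AEStronglyMeasurable g μ := by
  have := hg.aestronglyMeasurable_of_isCompact (μ := μ) h.isCompact h.isCompact.measurableSet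
  rwa [Measure.restrict_eq_self_of_ae_mem h.ae_mem] at this

/-- A nonzero value would persist on a relative neighbourhood, which has positive measure at a point
of the support. -/
theorem IsLatentPositionModel.eq_zero_of_ae (h : IsLatentPositionModel Z μ f)
    {g : EuclideanSpace ℝ (Fin d) → ℝ} (hg : ContinuousOn g Z) (hg0 : ∀ᵐ x ∂μ, g x = 0) :
    ∀ x ∈ Z, g x = 0 := by
  intro x hx
  by_contra hne
  have h1 : ∀ᶠ y in 𝓝[Z] x, g y ≠ 0 := (hg x hx).eventually_ne hne
  have h2 : {y | y ∈ Z → g y ≠ 0} ∈ 𝓝 x := eventually_nhdsWithin_iff.1 h1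
  have hx' : x ∈ μ.support := by rwa [h.support_eq]
  have h3 := (Measure.mem_support_iff_forall x).1 hx' _ h2
  refine h3.ne' (measure_mono_null (fun y hy => ?_) (ae_iff.1 (hg0.and h.ae_mem)))
  exact fun hc => hy hc.2 hc.1

section FeatureIntegral

variable {H : Type*} [NormedAddCommGroup H] [InnerProductSpace ℝ H]
  {k : EuclideanSpace ℝ (Fin d) → H}

theorem IsLatentPositionModel.norm_feature_le (h : IsLatentPositionModel Z μ f)
    (hk : ∀ x ∈ Z, ∀ y ∈ Z, ⟪k x, k y⟫_ℝ = f x y) {x : EuclideanSpace ℝ (Fin d)} (hx : x ∈ Z) :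
    ‖k x‖ ≤ 1 := by
  have h1 := (h.mem_Icc x hx x hx).2
  rw [← hk x hx x hx, real_inner_self_eq_norm_sq] at h1
  nlinarith [norm_nonneg (k x)]

theorem IsLatentPositionModel.integrable_smul_feature (h : IsLatentPositionModel Z μ f)
    (hk : ∀ x ∈ Z, ∀ y ∈ Z, ⟪k x, k y⟫_ℝ = f x y) {g : EuclideanSpace ℝ (Fin d) → ℝ}
    (hg : MemLp g 2 μ) : Integrable (fun y => g y • k y) μ := by
  have := h.isProbabilityMeasure
  have hmeas := h.aestronglyMeasurable (continuousOn_of_continuousOn_inner hk h.continuousOn)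
  refine (hg.integrable (by norm_num)).norm.mono' (hg.1.smul hmeas) ?_
  filter_upwards [h.ae_mem] with y hy
  rw [norm_smul]
  exact mul_le_of_le_one_right (norm_nonneg _) (h.norm_feature_le hk hy)

variable [CompleteSpace H]

theorem IsLatentPositionModel.inner_integral_feature (h : IsLatentPositionModel Z μ f)
    (hk : ∀ x ∈ Z, ∀ y ∈ Z, ⟪k x, k y⟫_ℝ = f x y) {g : EuclideanSpace ℝ (Fin d) → ℝ}
    (hg : MemLp g 2 μ) (a : H) : ⟪a, ∫ y, g y • k y ∂μ⟫_ℝ = ∫ y, g y * ⟪a, k y⟫_ℝ ∂μ := by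
  rw [← integral_inner (h.integrable_smul_feature hk hg)]
  simp only [real_inner_smul_right]

/-- The map `g ↦ ∫ g k dμ` is adjoint to `a ↦ ⟪a, k ·⟫` from `H` to `L₂(μ)`; composing the two gives
the integral operator. -/
theorem IsLatentPositionModel.feature_inner_integral (h : IsLatentPositionModel Z μ f)
    (hk : ∀ x ∈ Z, ∀ y ∈ Z, ⟪k x, k y⟫_ℝ = f x y) {g : EuclideanSpace ℝ (Fin d) → ℝ}
    (hg : MemLp g 2 μ) {x : EuclideanSpace ℝ (Fin d)} (hx : x ∈ Z) :
    ⟪k x, ∫ y, g y • k y ∂μ⟫_ℝ = ∫ y, f x y * g y ∂μ := by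
  rw [h.inner_integral_feature hk hg]
  refine integral_congr_ae ?_
  filter_upwards [h.ae_mem] with y hy
  rw [hk x hx y hy, mul_comm]

theorem IsMercerSystem.inner_integral_eigenfunction (h : IsLatentPositionModel Z μ f)
    (hm : IsMercerSystem Z μ f lam u) (hk : ∀ x ∈ Z, ∀ y ∈ Z, ⟪k x, k y⟫_ℝ = f x y) (l m : ℕ) :
    ⟪∫ y, u l y • k y ∂μ, ∫ y, u m y • k y ∂μ⟫_ℝ = if l = m then lam l else 0 := by
  rw [h.inner_integral_feature hk (hm.memLp m)]
  have h1 : ∫ y, u m y * ⟪∫ y, u l y • k y ∂μ, k y⟫_ℝ ∂μ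
      = ∫ y, lam l * (u l y * u m y) ∂μ := by
    refine integral_congr_ae ?_
    filter_upwards [h.ae_mem] with y hy
    rw [real_inner_comm, h.feature_inner_integral hk (hm.memLp l) hy, hm.eigen l y hy]
    ring
  rw [h1, integral_const_mul, hm.orthonormal]
  split_ifs <;> simp

/-- The function `g = ⟪a, k ·⟫` is orthogonal to every `u l`, so completeness annihilates it. Then
`‖∫ g k‖² = 0`, whence `∫ g² = ⟪a, ∫ g k⟫ = 0`, and continuity removes the exceptional null set. -/
theorem IsMercerSystem.eq_zero_of_inner_eq_zero (h : IsLatentPositionModel Z μ f)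
    (hm : IsMercerSystem Z μ f lam u) (hk : ∀ x ∈ Z, ∀ y ∈ Z, ⟪k x, k y⟫_ℝ = f x y)
    {a : H} (ha : ∀ l, ⟪a, ∫ y, u l y • k y ∂μ⟫_ℝ = 0) : ∀ x ∈ Z, ⟪a, k x⟫_ℝ = 0 := by
  have := h.isProbabilityMeasure
  have hcont : ContinuousOn (fun y => ⟪a, k y⟫_ℝ) Z :=
    continuousOn_const.inner (𝕜 := ℝ) (continuousOn_of_continuousOn_inner hk h.continuousOn)
  have hg : MemLp (fun y => ⟪a, k y⟫_ℝ) 2 μ := by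
    refine MemLp.of_bound (h.aestronglyMeasurable hcont) ‖a‖ ?_
    filter_upwards [h.ae_mem] with y hy
    refine (norm_inner_le_norm a (k y)).trans ?_
    exact mul_le_of_le_one_right (norm_nonneg _) (h.norm_feature_le hk hy)
  have hzero := hm.complete _ hg fun l => by
    rw [← h.inner_integral_feature hk (hm.memLp l), ha l]
  have hΦ : ∫ y, ⟪a, k y⟫_ℝ • k y ∂μ = 0 := by
    rw [← inner_self_eq_zero (𝕜 := ℝ), h.inner_integral_feature hk hg]
    refine integral_eq_zero_of_ae ?_
    filter_upwards [h.ae_mem, hzero] with y hy hy0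
    rw [real_inner_comm (k y) (∫ z, ⟪a, k z⟫_ℝ • k z ∂μ), h.feature_inner_integral hk hg hy, hy0]
    simp
  have hsq : ∫ y, ⟪a, k y⟫_ℝ * ⟪a, k y⟫_ℝ ∂μ = 0 := by
    rw [← h.inner_integral_feature hk hg a, hΦ, inner_zero_right]
  have hae := (integral_eq_zero_iff_of_nonneg (fun y => mul_self_nonneg _)
    (hg.integrable_mul hg)).1 hsq
  refine h.eq_zero_of_ae hcont ?_
  filter_upwards [hae] with y hy
  simpa using hy

end FeatureIntegral

/-- Mercer's theorem, with the expansion holding at every pair of points of `Z`. -/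
theorem IsMercerSystem.hasSum (h : IsLatentPositionModel Z μ f)
    (hm : IsMercerSystem Z μ f lam u) {x y : EuclideanSpace ℝ (Fin d)} (hx : x ∈ Z) (hy : y ∈ Z) :
    HasSum (fun l => (√(lam l) * u l x) * (√(lam l) * u l y)) (f x y) := by
  obtain ⟨H, _, _, _, k, hk, htot⟩ := exists_total_feature_map Z f h.symm h.posSemidef
  set S : Set ℕ := {l | 0 < lam l}
  -- The normalised images of the eigenfunctions with positive eigenvalue form a Hilbert basis of
  -- `H`; Parseval's identity in this basis is the Mercer expansion.
  let v : S → H := fun l => (√(lam l))⁻¹ • ∫ y, u l y • k y ∂μ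
  have hS : ∀ l : S, 0 < √(lam l) := fun l => Real.sqrt_pos.2 l.2
  have hv : Orthonormal ℝ v := by
    classical
    rw [orthonormal_iff_ite]
    intro l m
    simp only [v]
    rw [real_inner_smul_left, real_inner_smul_right, hm.inner_integral_eigenfunction h hk]
    by_cases hlm : l = m
    · subst hlm
      simp only [if_true]
      have := Real.mul_self_sqrt l.2.le
      field_simp [(hS l).ne']
      rw [sq, this]
    · rw [if_neg (fun hc => hlm (Subtype.ext hc)), if_neg hlm, mul_zero, mul_zero]
  have hbot : (Submodule.span ℝ (Set.range v))ᗮ = ⊥ := by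
    rw [Submodule.eq_bot_iff]
    intro a ha
    refine htot a (hm.eq_zero_of_inner_eq_zero h hk fun l => ?_)
    rcases (hm.nonneg l).eq_or_lt with h0 | h0
    · have : ∫ y, u l y • k y ∂μ = 0 := by
        rw [← inner_self_eq_zero (𝕜 := ℝ), hm.inner_integral_eigenfunction h hk, if_pos rfl, h0]
      rw [this, inner_zero_right]
    · have h1 := ha (v ⟨l, h0⟩) (Submodule.subset_span ⟨_, rfl⟩)
      simp only [v] at h1
      rw [real_inner_smul_left, mul_eq_zero] at h1
      rw [real_inner_comm]
      exact h1.resolve_left (inv_ne_zero (hS ⟨l, h0⟩).ne')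
  have hval : ∀ l : S, ∀ z ∈ Z, ⟪k z, v l⟫_ℝ = √(lam l) * u l z := by
    intro l z hz
    simp only [v]
    rw [real_inner_smul_right, h.feature_inner_integral hk (hm.memLp l) hz, hm.eigen l z hz,
      ← mul_assoc]
    congr 1
    rw [inv_mul_eq_div, div_eq_iff (hS l).ne', Real.mul_self_sqrt l.2.le]
  have hsum := (HilbertBasis.mkOfOrthogonalEqBot hv hbot).hasSum_inner_mul_inner (k x) (k y)
  rw [HilbertBasis.coe_mkOfOrthogonalEqBot, hk x hx y hy] at hsum
  -- Indices with zero eigenvalue contribute zero terms.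
  rw [← hasSum_subtype_iff_of_support_subset (s := S)]
  · refine hsum.congr_fun fun l => ?_
    rw [hval l x hx, real_inner_comm, hval l y hy]
    rfl
  · intro l hl
    by_contra hc
    have : √(lam l) = 0 := Real.sqrt_eq_zero_of_nonpos (not_lt.1 hc)
    simp [this] at hl

theorem inner_mercerFeatureMap (h : IsLatentPositionModel Z μ f)
    (hm : IsMercerSystem Z μ f lam u) :
    ∀ x ∈ Z, ∀ y ∈ Z, ⟪mercerFeatureMap lam u x, mercerFeatureMap lam u y⟫_ℝ = f x y := by
  -- The diagonal expansion gives square summability, so the default value 0 never occurs on `Z`.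
  have hmem : ∀ x ∈ Z, Memℓp (fun l : ℕ => √(lam l) * u l x) 2 := fun x hx => by
    refine memℓp_gen ?_
    have := (hm.hasSum h hx hx).summable
    simpa only [← sq, Real.norm_eq_abs, ENNReal.toReal_ofNat, Real.rpow_ofNat, sq_abs] using this
  intro x hx y hy
  rw [mercerFeatureMap, dif_pos (hmem x hx), mercerFeatureMap, dif_pos (hmem y hy)]
  refine (lp.hasSum_inner _ _).unique ?_
  refine (hm.hasSum h hx hy).congr_fun fun l => ?_
  simp [mul_comm]

end Mercer

/-! ### Differentiability of the feature map -/

section Derivative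

theorem exists_lineDeriv_eq_sub {V : Type*} [AddCommGroup V] [Module ℝ V] {G : V → ℝ} {y v : V}
    (h : ∀ r ∈ Set.Icc (0 : ℝ) 1, LineDifferentiableAt ℝ G (y + r • v) v) :
    ∃ r ∈ Set.Icc (0 : ℝ) 1, G (y + v) - G y = lineDeriv ℝ G (y + r • v) v := by
  have hd : ∀ r ∈ Set.Icc (0 : ℝ) 1,
      HasDerivAt (fun t : ℝ => G (y + t • v)) (lineDeriv ℝ G (y + r • v) v) r := by
    intro r hr
    have h1 : HasDerivAt (fun t : ℝ => G (y + r • v + t • v)) (lineDeriv ℝ G (y + r • v) v)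
        (r - r) := by
      rw [sub_self]
      exact (h r hr).hasLineDerivAt
    have h2 := h1.comp_sub_const r r
    refine h2.congr_of_eventuallyEq (Eventually.of_forall fun t => ?_)
    simp only [sub_smul]
    congr 1
    abel
  obtain ⟨r, hr, hs⟩ := exists_hasDerivAt_eq_slope (fun t : ℝ => G (y + t • v))
    (fun r => lineDeriv ℝ G (y + r • v) v) zero_lt_one
    (fun r hr => (hd r hr).continuousAt.continuousWithinAt)
    (fun r hr => hd r (Set.Ioo_subset_Icc_self hr))
  refine ⟨r, Set.Ioo_subset_Icc_self hr, ?_⟩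
  simpa using hs.symm

/-- Expanding, `‖q s - q t‖²` tends to `c - 2c + c = 0`, so `q` is Cauchy. -/
theorem exists_tendsto_of_tendsto_inner {ι H : Type*} [NormedAddCommGroup H]
    [InnerProductSpace ℝ H] [CompleteSpace H] {l : Filter ι} [l.NeBot] {q : ι → H} {c : ℝ}
    (h : Tendsto (fun p : ι × ι => ⟪q p.1, q p.2⟫_ℝ) (l ×ˢ l) (𝓝 c)) :
    ∃ J, Tendsto q l (𝓝 J) := by
  refine CompleteSpace.complete (f := map q l) ?_
  refine cauchy_map_iff.2 ⟨‹_›, tendsto_uniformity_iff_dist_tendsto_zero.2 ?_⟩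
  have h1 : Tendsto (fun p : ι × ι => ⟪q p.1, q p.1⟫_ℝ) (l ×ˢ l) (𝓝 c) :=
    h.comp (tendsto_fst.prodMk tendsto_fst)
  have h2 : Tendsto (fun p : ι × ι => ⟪q p.2, q p.2⟫_ℝ) (l ×ˢ l) (𝓝 c) :=
    h.comp (tendsto_snd.prodMk tendsto_snd)
  have h3 := ((h1.sub (h.const_mul 2)).add h2).sqrt
  rw [show c - 2 * c + c = 0 by ring, Real.sqrt_zero] at h3
  refine h3.congr fun p => ?_
  rw [real_inner_self_eq_norm_sq, real_inner_self_eq_norm_sq, ← norm_sub_sq_real,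
    Real.sqrt_sq (norm_nonneg _), dist_eq_norm]

variable {d : ℕ} {Z : Set (EuclideanSpace ℝ (Fin d))}
  {f : EuclideanSpace ℝ (Fin d) → EuclideanSpace ℝ (Fin d) → ℝ}
  {H : Type*} [NormedAddCommGroup H] [InnerProductSpace ℝ H]
  {φ : EuclideanSpace ℝ (Fin d) → H} {z : EuclideanSpace ℝ (Fin d)}

theorem add_smul_mem_of_convex {V : Type*} [AddCommGroup V] [Module ℝ V] {B : Set V}
    (hB : Convex ℝ B) {x v : V} (hx : x ∈ B) (hxv : x + v ∈ B) {r : ℝ}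
    (hr : r ∈ Set.Icc (0 : ℝ) 1) : x + r • v ∈ B := by
  simpa using hB.add_smul_sub_mem hx hxv hr

/-- The inner product is a double difference of `f`. The mean value theorem is applied in the second
variable, then in the first; convexity keeps the segments in `B`. -/
theorem exists_inner_sub_eq_mixedHessian (hf : HasLipschitzMixedDerivatives Z f)
    (hφ : ∀ x ∈ Z, ∀ y ∈ Z, ⟪φ x, φ y⟫_ℝ = f x y) {B : Set (EuclideanSpace ℝ (Fin d))}
    (hB : Convex ℝ B) (hBZ : B ⊆ interior Z) {x y : EuclideanSpace ℝ (Fin d)} {i j : Fin d}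
    {s t : ℝ} (hx : x ∈ B) (hx' : x + s • EuclideanSpace.single i (1 : ℝ) ∈ B) (hy : y ∈ B)
    (hy' : y + t • EuclideanSpace.single j (1 : ℝ) ∈ B) :
    ∃ x' ∈ B, ∃ y' ∈ B,
      ⟪φ (x + s • EuclideanSpace.single i (1 : ℝ)) - φ x,
        φ (y + t • EuclideanSpace.single j (1 : ℝ)) - φ y⟫_ℝ
        = s * t * mixedHessian f x' y' i j := by
  set xs := x + s • EuclideanSpace.single i (1 : ℝ) with hxs
  have hd : ∀ a ∈ B, ∀ b ∈ B, LineDifferentiableAt ℝ (fun y' => f a y') b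
      (t • EuclideanSpace.single j (1 : ℝ)) := fun a ha b hb =>
    (hf.differentiable_snd j a (hBZ ha) b (hBZ hb)).smul t
  have hBy : ∀ r ∈ Set.Icc (0 : ℝ) 1, y + r • t • EuclideanSpace.single j (1 : ℝ) ∈ B :=
    fun r hr => add_smul_mem_of_convex hB hy hy' hr
  have hBx : ∀ r ∈ Set.Icc (0 : ℝ) 1, x + r • s • EuclideanSpace.single i (1 : ℝ) ∈ B :=
    fun r hr => add_smul_mem_of_convex hB hx hx' hr
  obtain ⟨r, hr, hG⟩ := exists_lineDeriv_eq_sub (G := fun y' => f xs y' - f x y') (y := y)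
    (v := t • EuclideanSpace.single j (1 : ℝ))
    (fun r hr => (hd xs hx' _ (hBy r hr)).sub (hd x hx _ (hBy r hr)))
  set y' := y + r • t • EuclideanSpace.single j (1 : ℝ) with hy'def
  have hy'B : y' ∈ B := hBy r hr
  obtain ⟨r', hr', hF⟩ := exists_lineDeriv_eq_sub (G := fun x' => partialSnd f j x' y') (y := x)
    (v := s • EuclideanSpace.single i (1 : ℝ))
    (fun r hr => (hf.differentiable_fst i j _ (hBZ (hBx r hr)) y' (hBZ hy'B)).smul s)
  refine ⟨_, hBx r' hr', y', hy'B, ?_⟩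
  have hZ : ∀ a ∈ B, a ∈ Z := fun a ha => interior_subset (hBZ ha)
  rw [inner_sub_left, inner_sub_right, inner_sub_right, hφ _ (hZ _ hx') _ (hZ _ hy'),
    hφ _ (hZ _ hx') _ (hZ _ hy), hφ _ (hZ _ hx) _ (hZ _ hy'), hφ _ (hZ _ hx) _ (hZ _ hy)]
  have hline : lineDeriv ℝ (fun y' => f xs y' - f x y') y'
      (t • EuclideanSpace.single j (1 : ℝ)) = t * (partialSnd f j xs y' - partialSnd f j x y') := by
    have h1 := HasLineDerivAt.lineDeriv (𝕜 := ℝ) (f := fun y' => f xs y' - f x y')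
      ((hd xs hx' _ hy'B).hasLineDerivAt.sub (hd x hx _ hy'B).hasLineDerivAt)
    rw [h1, lineDeriv_smul, lineDeriv_smul, partialSnd, partialSnd, mul_sub, smul_eq_mul,
      smul_eq_mul]
  rw [lineDeriv_smul] at hF
  simp only [mixedHessian, Matrix.of_apply]
  simp only [smul_eq_mul] at hF
  have : f xs (y + t • EuclideanSpace.single j (1 : ℝ)) -
      f x (y + t • EuclideanSpace.single j (1 : ℝ)) - (f xs y - f x y)
      = t * (s * lineDeriv ℝ (fun x' => partialSnd f j x' y')
        (x + r' • s • EuclideanSpace.single i (1 : ℝ)) (EuclideanSpace.single i 1)) := by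
    rw [hG, hline, hF]
  linarith

theorem exists_ball_inner_sub_approx (hf : HasLipschitzMixedDerivatives Z f)
    (hφ : ∀ x ∈ Z, ∀ y ∈ Z, ⟪φ x, φ y⟫_ℝ = f x y) (hz : z ∈ interior Z) {η : ℝ} (hη : 0 < η) :
    ∃ ρ > 0, Metric.ball z ρ ⊆ interior Z ∧ ∀ (i j : Fin d) (x y : EuclideanSpace ℝ (Fin d))
      (s t : ℝ), x ∈ Metric.ball z ρ → x + s • EuclideanSpace.single i (1 : ℝ) ∈ Metric.ball z ρ →
      y ∈ Metric.ball z ρ → y + t • EuclideanSpace.single j (1 : ℝ) ∈ Metric.ball z ρ →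
      |⟪φ (x + s • EuclideanSpace.single i (1 : ℝ)) - φ x,
        φ (y + t • EuclideanSpace.single j (1 : ℝ)) - φ y⟫_ℝ - s * t * mixedHessian f z z i j|
        ≤ η * (|s| * |t|) := by
  have hcont : ∀ᶠ p in 𝓝 (z, z), ∀ i j : Fin d,
      dist (mixedHessian f p.1 p.2 i j) (mixedHessian f z z i j) < η := by
    refine eventually_all.2 fun i => eventually_all.2 fun j => ?_
    have h1 : ContinuousAt (fun p : EuclideanSpace ℝ (Fin d) × EuclideanSpace ℝ (Fin d) =>
        mixedHessian f p.1 p.2 i j) (z, z) :=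
      (hf.continuousOn i j).continuousAt
        ((isOpen_interior.prod isOpen_interior).mem_nhds ⟨hz, hz⟩)
    exact Metric.tendsto_nhds.1 h1 η hη
  rw [nhds_prod_eq] at hcont
  obtain ⟨t, ht, htη⟩ := mem_prod_self_iff.1 hcont
  obtain ⟨ρ, hρ, hball⟩ := Metric.mem_nhds_iff.1 (inter_mem ht (isOpen_interior.mem_nhds hz))
  refine ⟨ρ, hρ, fun x hx => (hball hx).2, fun i j x y s t hx hx' hy hy' => ?_⟩
  obtain ⟨a, ha, b, hb, hab⟩ := exists_inner_sub_eq_mixedHessian hf hφ (convex_ball z ρ)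
    (fun x hx => (hball hx).2) hx hx' hy hy'
  rw [hab, ← mul_sub, abs_mul, abs_mul, mul_comm]
  have := htη (Set.mk_mem_prod (hball ha).1 (hball hb).1) i j
  rw [Real.dist_eq] at this
  exact mul_le_mul_of_nonneg_right this.le (by positivity)

theorem eventually_add_smul_mem_ball {ρ : ℝ} (hρ : 0 < ρ) (v : EuclideanSpace ℝ (Fin d)) :
    ∀ᶠ s in 𝓝[≠] (0 : ℝ), s ≠ 0 ∧ z + s • v ∈ Metric.ball z ρ := by
  refine eventually_mem_nhdsWithin.and (mem_nhdsWithin_of_mem_nhds ?_)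
  have : ContinuousAt (fun s : ℝ => z + s • v) 0 := by fun_prop
  exact this.preimage_mem_nhds (by simpa using Metric.ball_mem_nhds z hρ)

theorem tendsto_inner_slope (hf : HasLipschitzMixedDerivatives Z f)
    (hφ : ∀ x ∈ Z, ∀ y ∈ Z, ⟪φ x, φ y⟫_ℝ = f x y) (hz : z ∈ interior Z) (i j : Fin d) :
    Tendsto (fun p : ℝ × ℝ =>
      ⟪p.1⁻¹ • (φ (z + p.1 • EuclideanSpace.single i (1 : ℝ)) - φ z),
        p.2⁻¹ • (φ (z + p.2 • EuclideanSpace.single j (1 : ℝ)) - φ z)⟫_ℝ)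
      (𝓝[≠] 0 ×ˢ 𝓝[≠] 0) (𝓝 (mixedHessian f z z i j)) := by
  refine Metric.tendsto_nhds.2 fun η hη => ?_
  obtain ⟨ρ, hρ, -, h⟩ := exists_ball_inner_sub_approx hf hφ hz (half_pos hη)
  filter_upwards [(eventually_add_smul_mem_ball (z := z) hρ (EuclideanSpace.single i 1)).prod_mk
    (eventually_add_smul_mem_ball (z := z) hρ (EuclideanSpace.single j 1))]
    with ⟨s, t⟩ ⟨⟨hs, hs'⟩, ⟨ht, ht'⟩⟩
  have h1 := h i j z z s t (Metric.mem_ball_self hρ) hs' (Metric.mem_ball_self hρ) ht'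
  rw [Real.dist_eq, real_inner_smul_left, real_inner_smul_right]
  refine lt_of_le_of_lt ?_ (half_lt_self hη)
  have hst : 0 < |s| * |t| := mul_pos (abs_pos.2 hs) (abs_pos.2 ht)
  refine le_of_mul_le_mul_right ?_ hst
  refine le_trans (le_of_eq ?_) h1
  rw [← abs_mul, ← abs_mul]
  congr 1
  dsimp only at hs ht ⊢
  field_simp

variable [CompleteSpace H]

/-- A map whose Gram kernel has continuous mixed second derivatives is Fréchet differentiable, and
the Gram matrix of its partial derivatives is the mixed Hessian. -/
theorem exists_partial_derivatives (hf : HasLipschitzMixedDerivatives Z f)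
    (hφ : ∀ x ∈ Z, ∀ y ∈ Z, ⟪φ x, φ y⟫_ℝ = f x y) (hz : z ∈ interior Z) :
    ∃ J : Fin d → H, (∀ i j, ⟪J i, J j⟫_ℝ = mixedHessian f z z i j) ∧
      ∀ η > 0, ∃ ρ > 0, ∀ x, ‖x - z‖ < ρ →
        ‖φ x - φ z - ∑ i, (x i - z i) • J i‖ ≤ η * ‖x - z‖ := by
  -- The difference quotients converge because their mutual inner products do.
  choose J hJ using fun i => exists_tendsto_of_tendsto_inner
    (q := fun s : ℝ => s⁻¹ • (φ (z + s • EuclideanSpace.single i (1 : ℝ)) - φ z)) (tendsto_inner_slope hf hφ hz i i)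
  have hgram : ∀ i j, ⟪J i, J j⟫_ℝ = mixedHessian f z z i j := fun i j =>
    tendsto_nhds_unique ((hJ i).inner (hJ j))
      ((tendsto_inner_slope hf hφ hz i j).comp (tendsto_id.prodMk tendsto_id))
  refine ⟨J, hgram, fun η hη => ?_⟩
  -- Expanding `‖Δ - s J i‖²` gives one error from `⟪Δ, Δ⟫` and two from `2 s ⟪Δ, J i⟫`, hence the
  -- factor 3. The factor `d + 1` absorbs the sum over coordinates.
  have hη' : 0 < (η / (d + 1)) ^ 2 / 3 := by positivity
  obtain ⟨ρ, hρ, -, h⟩ := exists_ball_inner_sub_approx hf hφ hz hη'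
  -- The bound is uniform in the base point `x`, as needed along a path of coordinate steps.
  have hstep : ∀ (i : Fin d) (x : EuclideanSpace ℝ (Fin d)) (s : ℝ), x ∈ Metric.ball z ρ →
      x + s • EuclideanSpace.single i (1 : ℝ) ∈ Metric.ball z ρ →
      ‖φ (x + s • EuclideanSpace.single i (1 : ℝ)) - φ x - s • J i‖ ≤ η / (d + 1) * |s| := by
    intro i x s hx hx'
    set Δ := φ (x + s • EuclideanSpace.single i (1 : ℝ)) - φ x
    have h1 := abs_le.1 (h i i x x s s hx hx' hx hx')
    have h2 : |⟪Δ, J i⟫_ℝ - s * mixedHessian f z z i i| ≤ (η / (d + 1)) ^ 2 / 3 * |s| := by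
      refine le_of_tendsto (((tendsto_const_nhds.inner (hJ i)).sub_const _).abs) ?_
      filter_upwards [eventually_add_smul_mem_ball (z := z) hρ (EuclideanSpace.single i 1)]
        with t ⟨ht, ht'⟩
      have h3 := h i i x z s t hx hx' (Metric.mem_ball_self hρ) ht'
      have ht0 : 0 < |t| := abs_pos.2 ht
      rw [real_inner_smul_right]
      refine le_of_mul_le_mul_right ?_ ht0
      rw [← abs_mul, mul_assoc]
      refine le_trans (le_of_eq ?_) h3
      congr 1
      field_simp
      rfl
    have h2' : |s * (⟪Δ, J i⟫_ℝ - s * mixedHessian f z z i i)|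
        ≤ (η / (d + 1)) ^ 2 / 3 * (|s| * |s|) := by
      rw [abs_mul]
      nlinarith [mul_le_mul_of_nonneg_left h2 (abs_nonneg s)]
    have h2'' := abs_le.1 h2'
    refine abs_le_of_sq_le_sq' ?_ (by positivity) |>.2
    rw [norm_sub_sq_real, real_inner_smul_right, norm_smul, mul_pow (‖s‖), mul_pow,
      ← real_inner_self_eq_norm_sq Δ, ← real_inner_self_eq_norm_sq (J i), hgram, Real.norm_eq_abs,
      sq_abs]
    rw [abs_mul_abs_self] at h1 h2''
    nlinarith [h1.2, h2''.1]
  -- Partial sums of the coordinate displacements have norm at most `d ‖x - z‖`, so the path stays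
  -- in the ball of radius `ρ`.
  refine ⟨ρ / (d + 1), by positivity, fun x hx => ?_⟩
  have hcoord : ∀ i, |x i - z i| ≤ ‖x - z‖ := fun i => by
    simpa using PiLp.norm_apply_le (x - z) i
  have hmem : ∀ S : Finset (Fin d),
      z + ∑ i ∈ S, (x i - z i) • EuclideanSpace.single i (1 : ℝ) ∈ Metric.ball z ρ := by
    intro S
    rw [mem_ball_iff_norm, add_sub_cancel_left]
    calc ‖∑ i ∈ S, (x i - z i) • EuclideanSpace.single i (1 : ℝ)‖
        ≤ ∑ i ∈ S, ‖x - z‖ := norm_sum_le_of_le _ fun i _ => by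
          rw [norm_smul]
          simpa using hcoord i
      _ ≤ d * ‖x - z‖ := by
          rw [Finset.sum_const, nsmul_eq_mul]
          refine mul_le_mul_of_nonneg_right ?_ (norm_nonneg _)
          exact_mod_cast (Finset.card_le_univ S).trans_eq (Fintype.card_fin d)
      _ ≤ (d + 1) * ‖x - z‖ := by nlinarith [norm_nonneg (x - z)]
      _ < ρ := by
          rw [lt_div_iff₀ (by positivity)] at hx
          linarith
  -- Telescoping, one coordinate at a time.
  have htel : ∀ S : Finset (Fin d),
      ‖φ (z + ∑ i ∈ S, (x i - z i) • EuclideanSpace.single i (1 : ℝ)) - φ z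
        - ∑ i ∈ S, (x i - z i) • J i‖ ≤ ∑ i ∈ S, η / (d + 1) * ‖x - z‖ := by
    intro S
    induction S using Finset.induction_on with
    | empty => simp
    | insert i S hi ih =>
      have hm := hmem (insert i S)
      rw [Finset.sum_insert hi, add_comm (_ • _), ← add_assoc] at hm
      have h4 := (hstep i _ _ (hmem S) hm).trans
        (mul_le_mul_of_nonneg_left (hcoord i) (by positivity))
      rw [Finset.sum_insert hi, Finset.sum_insert hi, Finset.sum_insert hi,
        add_comm ((x i - z i) • EuclideanSpace.single i (1 : ℝ)), ← add_assoc]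
      refine le_trans (le_of_eq ?_) ((norm_add_le _ _).trans (add_le_add h4 ih))
      congr 1
      abel
  have hx_eq : z + ∑ i, (x i - z i) • EuclideanSpace.single i (1 : ℝ) = x := by
    ext k
    simp [Finset.sum_apply, Pi.single_apply]
  have h5 := htel Finset.univ
  rw [hx_eq] at h5
  refine h5.trans ?_
  rw [Finset.sum_const, Finset.card_univ, Fintype.card_fin, nsmul_eq_mul, ← mul_assoc]
  refine mul_le_mul_of_nonneg_right ?_ (norm_nonneg _)
  rw [mul_div_assoc', div_le_iff₀ (by positivity)]
  nlinarith

end Derivative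

/-! ### The second-moment operator on `ℓ₂` -/

theorem not_finiteDimensional_ell2 : ¬ FiniteDimensional ℝ Ell2 := by
  intro h
  let b : HilbertBasis ℕ ℝ Ell2 := HilbertBasis.ofRepr (LinearIsometryEquiv.refl ℝ Ell2)
  have := b.orthonormal.linearIndependent.finite
  exact not_finite ℕ

section SecondMoment

variable {d : ℕ} {Z : Set (EuclideanSpace ℝ (Fin d))} {ν : Measure (EuclideanSpace ℝ (Fin d))}
  {φ : EuclideanSpace ℝ (Fin d) → Ell2} {z : EuclideanSpace ℝ (Fin d)}

theorem integrable_of_continuousOn {F : Type*} [NormedAddCommGroup F] [IsFiniteMeasure ν]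
    (hZ : IsCompact Z) (hν : ∀ᵐ x ∂ν, x ∈ Z) {g : EuclideanSpace ℝ (Fin d) → F}
    (hg : ContinuousOn g Z) : Integrable g ν := by
  have := hg.integrableOn_compact (μ := ν) hZ
  rwa [IntegrableOn, Measure.restrict_eq_self_of_ae_mem hν] at this

theorem continuousOn_increment (hφ : ContinuousOn φ Z) : ContinuousOn (increment φ z) Z := by
  have hψ : ContinuousOn (fun x => φ x - φ z) Z := hφ.sub continuousOn_const
  exact ((InnerProductSpace.rankOne ℝ).continuous.comp_continuousOn hψ).clm_apply hψ

theorem integrable_increment [IsFiniteMeasure ν] (hZ : IsCompact Z) (hν : ∀ᵐ x ∂ν, x ∈ Z)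
    (hφ : ContinuousOn φ Z) : Integrable (increment φ z) ν :=
  integrable_of_continuousOn hZ hν (continuousOn_increment hφ)

theorem inner_centredSecondMoment [IsFiniteMeasure ν] (hZ : IsCompact Z) (hν : ∀ᵐ x ∂ν, x ∈ Z)
    (hφ : ContinuousOn φ Z) (v w : Ell2) :
    ⟪centredSecondMoment φ z ν v, w⟫_ℝ = ∫ x, ⟪φ x - φ z, v⟫_ℝ * ⟪φ x - φ z, w⟫_ℝ ∂ν := by
  have hint := integrable_increment (z := z) hZ hν hφ
  rw [centredSecondMoment, ContinuousLinearMap.integral_apply hint, real_inner_comm,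
    ← integral_inner (hint.apply_continuousLinearMap v)]
  refine integral_congr_ae (Eventually.of_forall fun x => ?_)
  simp only [increment, InnerProductSpace.rankOne_apply, real_inner_smul_right]
  rw [real_inner_comm w]

theorem isPositive_centredSecondMoment [IsFiniteMeasure ν] (hZ : IsCompact Z)
    (hν : ∀ᵐ x ∂ν, x ∈ Z) (hφ : ContinuousOn φ Z) : (centredSecondMoment φ z ν).IsPositive := by
  refine ⟨fun v w => ?_, fun v => ?_⟩
  · change ⟪centredSecondMoment φ z ν v, w⟫_ℝ = ⟪v, centredSecondMoment φ z ν w⟫_ℝ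
    rw [inner_centredSecondMoment hZ hν hφ, real_inner_comm (centredSecondMoment φ z ν w) v,
      inner_centredSecondMoment hZ hν hφ]
    simp only [mul_comm]
  · rw [ContinuousLinearMap.reApplyInnerSelf_apply, RCLike.re_to_real,
      inner_centredSecondMoment hZ hν hφ]
    exact integral_nonneg fun x => mul_self_nonneg _

/-- Rank-one operators are compact, and a Bochner average stays in the closed subspace of compact
operators. -/
theorem isCompactOperator_centredSecondMoment [IsProbabilityMeasure ν] (hZ : IsCompact Z)
    (hν : ∀ᵐ x ∂ν, x ∈ Z) (hφ : ContinuousOn φ Z) :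
    IsCompactOperator (centredSecondMoment φ z ν) := by
  have hcl : IsClosed ((compactOperator (RingHom.id ℝ) Ell2 Ell2 : Submodule ℝ (Ell2 →L[ℝ] Ell2)) :
      Set (Ell2 →L[ℝ] Ell2)) := isClosed_setOfPred_isCompactOperator
  refine (compactOperator (RingHom.id ℝ) Ell2 Ell2).convex.integral_mem hcl
    (Eventually.of_forall fun x => ?_) (integrable_increment hZ hν hφ)
  change IsCompactOperator (increment φ z x)
  rw [increment, InnerProductSpace.rankOne_def']
  have h : IsCompactOperator (innerSL ℝ (φ x - φ z)) :=
    isCompactOperator_of_locallyCompactSpace_dom (innerSL ℝ (φ x - φ z))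
  exact h.clm_comp (ContinuousLinearMap.toSpanSingleton ℝ (φ x - φ z))

/-- The error of the linear approximation of `φ` at `z` with partial derivatives `J`. -/
noncomputable def linearRemainder (φ : EuclideanSpace ℝ (Fin d) → Ell2)
    (z : EuclideanSpace ℝ (Fin d)) (J : Fin d → Ell2) (x : EuclideanSpace ℝ (Fin d)) : Ell2 :=
  φ x - φ z - ∑ i, (x i - z i) • J i

variable {J : Fin d → Ell2}

theorem continuousOn_linearRemainder (hφ : ContinuousOn φ Z) :
    ContinuousOn (linearRemainder φ z J) Z := by
  unfold linearRemainder
  refine (hφ.sub continuousOn_const).sub (Continuous.continuousOn ?_)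
  fun_prop

/-- Vectors orthogonal to every `J i` see only the remainder; Bessel's inequality bounds the sum
pointwise. -/
theorem sum_inner_centredSecondMoment_le [IsFiniteMeasure ν] (hZ : IsCompact Z)
    (hν : ∀ᵐ x ∂ν, x ∈ Z) (hφ : ContinuousOn φ Z) {N : ℕ} {v : Fin N → Ell2}
    (hv : Orthonormal ℝ v) (hvJ : ∀ j, v j ∈ (Submodule.span ℝ (Set.range J))ᗮ) :
    ∑ j, ⟪centredSecondMoment φ z ν (v j), v j⟫_ℝ ≤ ∫ x, ‖linearRemainder φ z J x‖ ^ 2 ∂ν := by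
  have hR := continuousOn_linearRemainder (z := z) (J := J) hφ
  have hinner : ∀ x j, ⟪φ x - φ z, v j⟫_ℝ = ⟪linearRemainder φ z J x, v j⟫_ℝ := by
    intro x j
    have h0 : ⟪∑ i, (x i - z i) • J i, v j⟫_ℝ = 0 :=
      hvJ j _ (Submodule.sum_mem _ fun i _ => Submodule.smul_mem _ _
        (Submodule.subset_span ⟨i, rfl⟩))
    rw [linearRemainder, inner_sub_left (φ x - φ z), h0, sub_zero]
  simp only [inner_centredSecondMoment hZ hν hφ, hinner]
  have hcont : ∀ j, ContinuousOn (fun x => ⟪linearRemainder φ z J x, v j⟫_ℝ *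
      ⟪linearRemainder φ z J x, v j⟫_ℝ) Z := fun j =>
    (ContinuousOn.inner (𝕜 := ℝ) hR continuousOn_const).mul
      (ContinuousOn.inner (𝕜 := ℝ) hR continuousOn_const)
  rw [← integral_finsetSum _ fun j _ => integrable_of_continuousOn hZ hν (hcont j)]
  refine integral_mono
    (integrable_of_continuousOn hZ hν (continuousOn_finsetSum _ fun j _ => hcont j))
    (integrable_of_continuousOn hZ hν (hR.norm.pow 2)) fun x => ?_
  refine le_trans (le_of_eq (Finset.sum_congr rfl fun j _ => ?_)) (hv.sum_inner_products_le
    (x := linearRemainder φ z J x) (s := Finset.univ))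
  rw [real_inner_comm, Real.norm_eq_abs, sq_abs, sq]

/-- Pointwise this is `(a + b)² ≥ a²/2 - b²`, with Cauchy–Schwarz for the remainder term `b`. -/
theorem le_inner_centredSecondMoment [IsFiniteMeasure ν] (hZ : IsCompact Z)
    (hν : ∀ᵐ x ∂ν, x ∈ Z) (hφ : ContinuousOn φ Z) (v : Ell2) :
    (∫ x, ⟪∑ i, (x i - z i) • J i, v⟫_ℝ ^ 2 ∂ν) / 2
      - (∫ x, ‖linearRemainder φ z J x‖ ^ 2 ∂ν) * ‖v‖ ^ 2 ≤
        ⟪centredSecondMoment φ z ν v, v⟫_ℝ := by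
  have hR := continuousOn_linearRemainder (z := z) (J := J) hφ
  have hL : Continuous fun x : EuclideanSpace ℝ (Fin d) => ⟪∑ i, (x i - z i) • J i, v⟫_ℝ := by
    fun_prop
  have hI1 : Integrable (fun x => ⟪∑ i, (x i - z i) • J i, v⟫_ℝ ^ 2 / 2) ν :=
    integrable_of_continuousOn hZ hν ((hL.pow 2).div_const 2).continuousOn
  have hI2 : Integrable (fun x => ‖linearRemainder φ z J x‖ ^ 2 * ‖v‖ ^ 2) ν :=
    integrable_of_continuousOn hZ hν ((hR.norm.pow 2).mul continuousOn_const)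
  have hψ : ContinuousOn (fun x => ⟪φ x - φ z, v⟫_ℝ) Z :=
    ContinuousOn.inner (𝕜 := ℝ) (hφ.sub continuousOn_const) continuousOn_const
  rw [inner_centredSecondMoment hZ hν hφ, ← integral_div, ← integral_mul_const,
    ← integral_sub hI1 hI2]
  refine integral_mono (hI1.sub hI2) (integrable_of_continuousOn hZ hν (hψ.mul hψ)) fun x => ?_
  have hsum : ⟪φ x - φ z, v⟫_ℝ
      = ⟪∑ i, (x i - z i) • J i, v⟫_ℝ + ⟪linearRemainder φ z J x, v⟫_ℝ := by
    rw [← inner_add_left, linearRemainder, add_sub_cancel]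
  have hCS := abs_real_inner_le_norm (linearRemainder φ z J x) v
  have hCS2 := sq_le_sq' (by linarith [neg_abs_le ⟪linearRemainder φ z J x, v⟫_ℝ])
    ((le_abs_self _).trans hCS)
  rw [mul_pow] at hCS2
  rw [hsum]
  -- The difference `(a + b)² - a²/2 + b²` equals `(a + 2b)²/2`.
  nlinarith [sq_nonneg (⟪∑ i, (x i - z i) • J i, v⟫_ℝ + 2 * ⟪linearRemainder φ z J x, v⟫_ℝ)]

theorem integral_inner_linear_sq [IsFiniteMeasure ν] (hZ : IsCompact Z) (hν : ∀ᵐ x ∂ν, x ∈ Z)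
    {S : Matrix (Fin d) (Fin d) ℝ}
    (hS : ∀ i j, ∫ x, (x i - z i) * (x j - z j) ∂ν = S i j) (a : Fin d → ℝ) :
    ∫ x, (∑ i, (x i - z i) * a i) ^ 2 ∂ν = a ⬝ᵥ S.mulVec a := by
  have hint : ∀ i j, Integrable (fun x : EuclideanSpace ℝ (Fin d) =>
      a i * a j * ((x i - z i) * (x j - z j))) ν := fun i j =>
    integrable_of_continuousOn hZ hν (by fun_prop)
  have h1 : ∀ x : EuclideanSpace ℝ (Fin d), (∑ i, (x i - z i) * a i) ^ 2
      = ∑ i, ∑ j, a i * a j * ((x i - z i) * (x j - z j)) := fun x => by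
    rw [sq, Finset.sum_mul_sum]
    exact Finset.sum_congr rfl fun i _ => Finset.sum_congr rfl fun j _ => by ring
  simp only [h1]
  rw [integral_finsetSum _ fun i _ => integrable_finsetSum _ fun j _ => hint i j]
  simp only [dotProduct, Matrix.mulVec, Finset.mul_sum]
  refine Finset.sum_congr rfl fun i _ => ?_
  rw [integral_finsetSum _ fun j _ => hint i j]
  refine Finset.sum_congr rfl fun j _ => ?_
  rw [integral_const_mul, hS]
  ring

theorem integral_norm_sub_sq [IsFiniteMeasure ν] (hZ : IsCompact Z) (hν : ∀ᵐ x ∂ν, x ∈ Z)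
    {S : Matrix (Fin d) (Fin d) ℝ}
    (hS : ∀ i j, ∫ x, (x i - z i) * (x j - z j) ∂ν = S i j) :
    ∫ x, ‖x - z‖ ^ 2 ∂ν = S.trace := by
  simp only [EuclideanSpace.real_norm_sq_eq]
  simp only [PiLp.sub_apply, sq]
  rw [integral_finsetSum _ fun i _ => integrable_of_continuousOn hZ hν (by fun_prop)]
  exact Finset.sum_congr rfl fun i _ => hS i i

end SecondMoment

/-! ### Gram matrices and quadratic forms -/

section Rank

variable {d : ℕ} {H : Type*} [NormedAddCommGroup H] [InnerProductSpace ℝ H]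

/-- Since `aᵀ G a = ‖∑ a j J j‖²`, the Gram matrix and `a ↦ ∑ a j J j` have the same kernel;
rank–nullity concludes. -/
theorem rank_gram (J : Fin d → H) :
    (Matrix.gram ℝ J).rank = Module.finrank ℝ (Submodule.span ℝ (Set.range J)) := by
  have hker : LinearMap.ker (Fintype.linearCombination ℝ J)
      = LinearMap.ker (Matrix.gram ℝ J).mulVecLin := by
    ext a
    simp only [LinearMap.mem_ker, Fintype.linearCombination_apply, Matrix.mulVecLin_apply]
    constructor
    · intro h
      ext i
      have : ⟪J i, ∑ j, a j • J j⟫_ℝ = 0 := by rw [h, inner_zero_right]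
      simpa [Matrix.mulVec, dotProduct, inner_sum, real_inner_smul_right, mul_comm] using this
    · intro h
      have h1 := Matrix.star_dotProduct_gram_mulVec (𝕜 := ℝ) J a a
      rw [h, dotProduct_zero] at h1
      exact inner_self_eq_zero.1 h1.symm
  have h1 := LinearMap.finrank_range_add_finrank_ker (Fintype.linearCombination ℝ J)
  have h2 := LinearMap.finrank_range_add_finrank_ker (Matrix.gram ℝ J).mulVecLin
  rw [hker, Fintype.range_linearCombination] at h1
  rw [Matrix.rank]
  omega

theorem posDef_of_rank_eq {S : Matrix (Fin d) (Fin d) ℝ} (hS : S.PosSemidef) (hr : S.rank = d) :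
    S.PosDef := by
  rw [hS.posDef_iff_isUnit, ← Matrix.mulVec_surjective_iff_isUnit]
  have h : LinearMap.range S.mulVecLin = ⊤ := by
    refine Submodule.eq_top_of_finrank_eq ?_
    rw [← Matrix.rank, hr]
    simp
  exact LinearMap.range_eq_top.1 h

/-- On the span of `J`, the quadratic form with coefficients in a positive definite matrix
dominates the squared norm. -/
theorem exists_pos_mul_norm_sq_le {S : Matrix (Fin d) (Fin d) ℝ} (hS : S.PosDef)
    (J : Fin d → H) :
    ∃ c > 0, ∀ v ∈ Submodule.span ℝ (Set.range J),
      c * ‖v‖ ^ 2 ≤ (fun i => ⟪J i, v⟫_ℝ) ⬝ᵥ S.mulVec fun i => ⟪J i, v⟫_ℝ := by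
  set Q := Submodule.span ℝ (Set.range J)
  have : FiniteDimensional ℝ Q := FiniteDimensional.span_of_finite ℝ (Set.finite_range J)
  set q : H → ℝ := fun v => (fun i => ⟪J i, v⟫_ℝ) ⬝ᵥ S.mulVec fun i => ⟪J i, v⟫_ℝ with hq
  have hqc : Continuous fun v : Q => q v := by
    simp only [hq, dotProduct, Matrix.mulVec]
    fun_prop
  -- A nonzero vector of the span cannot be orthogonal to every `J i`.
  have hqpos : ∀ v ∈ Q, v ≠ 0 → 0 < q v := by
    intro v hv hv0
    have hne : (fun i => ⟪J i, v⟫_ℝ) ≠ 0 := by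
      intro h
      refine hv0 (inner_self_eq_zero (𝕜 := ℝ).1 ?_)
      have hperp : ∀ w ∈ Q, ⟪w, v⟫_ℝ = 0 := by
        intro w hw
        induction hw using Submodule.span_induction with
        | mem w hw => obtain ⟨i, rfl⟩ := hw; exact congrFun h i
        | zero => simp
        | add a b _ _ ha hb => rw [inner_add_left, ha, hb, add_zero]
        | smul a b _ hb => rw [real_inner_smul_left, hb, mul_zero]
      exact hperp v hv
    simpa using hS.dotProduct_mulVec_pos hne
  have hsmul : ∀ (a : ℝ) (v : H), q (a • v) = a ^ 2 * q v := by
    intro a v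
    simp only [hq, real_inner_smul_right]
    change (a • fun i => ⟪J i, v⟫_ℝ) ⬝ᵥ S.mulVec (a • fun i => ⟪J i, v⟫_ℝ) = _
    rw [Matrix.mulVec_smul, dotProduct_smul, smul_dotProduct, smul_eq_mul, smul_eq_mul]
    ring
  suffices h : ∃ c > 0, ∀ v ∈ Metric.sphere (0 : Q) 1, c ≤ q v by
    obtain ⟨c, hc, h⟩ := h
    refine ⟨c, hc, fun v hv => ?_⟩
    rcases eq_or_ne v 0 with rfl | hv0
    · simp
    have hn : 0 < ‖v‖ := norm_pos_iff.2 hv0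
    have h1 := h ⟨‖v‖⁻¹ • v, Q.smul_mem _ hv⟩ (by
      rw [mem_sphere_zero_iff_norm]
      exact norm_smul_inv_norm (𝕜 := ℝ) hv0)
    simp only [hsmul] at h1
    change c * ‖v‖ ^ 2 ≤ q v
    rw [inv_pow, inv_mul_eq_div, le_div_iff₀ (by positivity)] at h1
    exact h1
  -- The sphere is empty when `Q` is trivial; otherwise the minimum over it is attained and
  -- positive.
  rcases (Metric.sphere (0 : Q) 1).eq_empty_or_nonempty with he | hne
  · exact ⟨1, one_pos, by simp [he]⟩
  · obtain ⟨w, hw, hmin⟩ := (isCompact_sphere (0 : Q) 1).exists_isMinOn hne hqc.continuousOn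
    refine ⟨q w, hqpos w w.2 ?_, fun v hv => hmin hv⟩
    intro h0
    rw [mem_sphere_zero_iff_norm, Submodule.coe_norm, h0, norm_zero] at hw
    exact zero_ne_one hw

end Rank

/-! ### Reweighted measures and their second moments -/

section Weighted

variable {d : ℕ} {μ : Measure (EuclideanSpace ℝ (Fin d))} {Z : Set (EuclideanSpace ℝ (Fin d))}

theorem isProbabilityMeasure_weightedMeasure {w : EuclideanSpace ℝ (Fin d) → ℝ}
    (hμ : ∀ᵐ x ∂μ, x ∈ Z) (hpos : ∀ x ∈ Z, 0 < w x) (hint : ∫ x, w x ∂μ = 1) :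
    IsProbabilityMeasure (weightedMeasure μ w) := by
  -- A non-integrable `w` would have integral 0 by convention, not 1.
  have hi : Integrable w μ := by
    by_contra h
    rw [integral_undef h] at hint
    exact zero_ne_one hint
  refine ⟨?_⟩
  rw [weightedMeasure, withDensity_apply _ MeasurableSet.univ, setLIntegral_univ,
    ← ofReal_integral_eq_lintegral_ofReal hi (hμ.mono fun x hx => (hpos x hx).le), hint,
    ENNReal.ofReal_one]

theorem ae_mem_weightedMeasure {w : EuclideanSpace ℝ (Fin d) → ℝ} (hμ : ∀ᵐ x ∂μ, x ∈ Z) :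
    ∀ᵐ x ∂(weightedMeasure μ w), x ∈ Z :=
  (withDensity_absolutelyContinuous μ _).ae_le hμ

end Weighted

/-- Only the rank of `Σ` is assumed; positivity comes from its being a scaled second-moment matrix.
-/
theorem posSemidef_of_second_moment {d : ℕ} {Z : Set (EuclideanSpace ℝ (Fin d))}
    {ρ : Measure (EuclideanSpace ℝ (Fin d))} [IsFiniteMeasure ρ] {z : EuclideanSpace ℝ (Fin d)}
    (hZ : IsCompact Z) (hρ : ∀ᵐ x ∂ρ, x ∈ Z) {S : Matrix (Fin d) (Fin d) ℝ} {ε : ℝ} (hε : 0 < ε)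
    (hcov : ∀ i j, ∫ x, (x i - z i) * (x j - z j) ∂ρ = ε * S i j) : S.PosSemidef := by
  refine Matrix.PosSemidef.of_dotProduct_mulVec_nonneg ?_ fun a => ?_
  · ext i j
    have h : ε * S j i = ε * S i j := by
      rw [← hcov, ← hcov]
      simp only [mul_comm]
    simpa using mul_left_cancel₀ hε.ne' h
  · have h := integral_inner_linear_sq (S := ε • S) hZ hρ
      (fun i j => by simpa using hcov i j) a
    rw [Matrix.smul_mulVec, dotProduct_smul, smul_eq_mul] at h
    have h0 : 0 ≤ ε * (a ⬝ᵥ S.mulVec a) := h ▸ integral_nonneg fun x => sq_nonneg _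
    simpa using nonneg_of_mul_nonneg_right h0 hε

/-! ### Asymptotics as `ε → 0` -/

section Asymptotics

variable {d : ℕ} {Z : Set (EuclideanSpace ℝ (Fin d))}
  {ν : ℝ → Measure (EuclideanSpace ℝ (Fin d))} {φ : EuclideanSpace ℝ (Fin d) → Ell2}
  {z : EuclideanSpace ℝ (Fin d)} {ε₀ : ℝ} {S : Matrix (Fin d) (Fin d) ℝ} {J : Fin d → Ell2}

theorem integral_linearRemainder_isLittleO (hε₀ : 0 < ε₀) (hZ : IsCompact Z)
    (hφ : ContinuousOn φ Z) (hprob : ∀ ε ∈ Set.Ioo 0 ε₀, IsProbabilityMeasure (ν ε))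
    (hmem : ∀ ε ∈ Set.Ioo 0 ε₀, ∀ᵐ x ∂(ν ε), x ∈ Z)
    (hcov : ∀ ε ∈ Set.Ioo 0 ε₀, ∀ i j, ∫ x, (x i - z i) * (x j - z j) ∂(ν ε) = ε * S i j)
    (hmom : (fun ε : ℝ => ∫ x, ‖x - z‖ ^ (3 : ℝ) ∂(ν ε)) =o[𝓝[>] 0] fun ε : ℝ => ε)
    (hJ : ∀ η > 0, ∃ ρ > 0, ∀ x, ‖x - z‖ < ρ → ‖linearRemainder φ z J x‖ ≤ η * ‖x - z‖) :
    (fun ε : ℝ => ∫ x, ‖linearRemainder φ z J x‖ ^ 2 ∂(ν ε)) =o[𝓝[>] 0] fun ε : ℝ => ε := by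
  have hR := continuousOn_linearRemainder (z := z) (J := J) hφ
  have htr : ∀ ε ∈ Set.Ioo 0 ε₀, ∫ x, ‖x - z‖ ^ 2 ∂(ν ε) = ε * S.trace := by
    intro ε hε
    have := hprob ε hε
    rw [integral_norm_sub_sq (S := ε • S) hZ (hmem ε hε)
      (fun i j => by simpa using hcov ε hε i j), Matrix.trace_smul, smul_eq_mul]
  have hS0 : 0 ≤ S.trace := by
    have h1 := htr (ε₀ / 2) ⟨by positivity, by linarith⟩
    have h2 : 0 ≤ ε₀ / 2 * S.trace := h1 ▸ integral_nonneg fun x => by positivity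
    exact nonneg_of_mul_nonneg_right h2 (by positivity)
  obtain ⟨C, hC⟩ := hZ.exists_bound_of_continuousOn (hR.norm.pow 2)
  refine isLittleO_iff.2 fun c hc => ?_
  -- The near and far regions each contribute at most `c/2 · ε`. In the far region `1 ≤ ‖x - z‖³ /
  -- ρ³`, which gives `K`. The summands 1 in the denominators guard against zero.
  obtain ⟨ρ, hρ, hnear⟩ := hJ (√(c / 2 / (S.trace + 1))) (by positivity)
  set K := |C| / ρ ^ 3 with hK
  have hK0 : 0 ≤ K := by positivity
  filter_upwards [Ioo_mem_nhdsGT hε₀, isLittleO_iff.1 hmom (c := c / 2 / (K + 1)) (by positivity)]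
    with ε hε hεm
  have := hprob ε hε
  have hbound : ∀ x ∈ Z, ‖linearRemainder φ z J x‖ ^ 2 ≤
      c / 2 / (S.trace + 1) * ‖x - z‖ ^ 2 + K * ‖x - z‖ ^ (3 : ℝ) := by
    intro x hx
    rcases lt_or_ge ‖x - z‖ ρ with h | h
    · have h1 := pow_le_pow_left₀ (norm_nonneg _) (hnear x h) 2
      rw [mul_pow, Real.sq_sqrt (by positivity)] at h1
      have : 0 ≤ K * ‖x - z‖ ^ (3 : ℝ) := by positivity
      linarith
    · have h1 : ‖linearRemainder φ z J x‖ ^ 2 ≤ |C| := by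
        have := hC x hx
        rw [Pi.pow_apply, Real.norm_of_nonneg (by positivity)] at this
        exact this.trans (le_abs_self C)
      have h2 : |C| ≤ K * ‖x - z‖ ^ (3 : ℝ) := by
        rw [hK, div_mul_eq_mul_div, le_div_iff₀ (by positivity), Real.rpow_ofNat]
        exact mul_le_mul_of_nonneg_left (pow_le_pow_left₀ hρ.le h 3) (abs_nonneg C)
      have : 0 ≤ c / 2 / (S.trace + 1) * ‖x - z‖ ^ 2 := by positivity
      linarith
  have hI2 : Integrable (fun x => c / 2 / (S.trace + 1) * ‖x - z‖ ^ 2) (ν ε) :=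
    integrable_of_continuousOn hZ (hmem ε hε) (by fun_prop)
  have hI3 : Integrable (fun x => K * ‖x - z‖ ^ (3 : ℝ)) (ν ε) :=
    integrable_of_continuousOn hZ (hmem ε hε) (by
      simp only [Real.rpow_ofNat]
      fun_prop)
  have hle := integral_mono_ae (integrable_of_continuousOn hZ (hmem ε hε) (hR.norm.pow 2))
    (hI2.add hI3) ((hmem ε hε).mono hbound)
  simp only [Pi.add_apply, Pi.pow_apply] at hle
  rw [integral_add hI2 hI3, integral_const_mul, integral_const_mul, htr ε hε] at hle
  have hε0 : 0 < ε := hε.1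
  have hm0 : 0 ≤ ∫ x, ‖x - z‖ ^ (3 : ℝ) ∂(ν ε) := integral_nonneg fun x => by positivity
  rw [Real.norm_of_nonneg hm0, Real.norm_of_nonneg hε0.le] at hεm
  rw [Real.norm_of_nonneg (integral_nonneg fun x => by positivity), Real.norm_of_nonneg hε0.le]
  have h1 : c / 2 / (S.trace + 1) * (ε * S.trace) ≤ c / 2 * ε := by
    rw [div_mul_eq_mul_div, div_le_iff₀ (by positivity)]
    nlinarith [mul_pos hc hε0]
  have h2 : K * ∫ x, ‖x - z‖ ^ (3 : ℝ) ∂(ν ε) ≤ c / 2 * ε := by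
    refine (mul_le_mul_of_nonneg_left hεm hK0).trans ?_
    rw [← mul_assoc, mul_div_assoc', div_mul_eq_mul_div, div_le_iff₀ (by positivity)]
    nlinarith [mul_pos hc hε0]
  linarith

theorem sum_range_eigenvalue_le {ρ : Measure (EuclideanSpace ℝ (Fin d))} [IsFiniteMeasure ρ]
    (hZ : IsCompact Z) (hρ : ∀ᵐ x ∂ρ, x ∈ Z) (hφ : ContinuousOn φ Z) (J : Fin d → Ell2) {r : ℕ}
    (hr : Module.finrank ℝ (Submodule.span ℝ (Set.range J)) ≤ r) (N : ℕ) :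
    ∑ i ∈ Finset.range N, eigenvalue (centredSecondMoment φ z ρ) (r + i)
      ≤ ∫ x, ‖linearRemainder φ z J x‖ ^ 2 ∂ρ := by
  have : FiniteDimensional ℝ (Submodule.span ℝ (Set.range J)) :=
    FiniteDimensional.span_of_finite ℝ (Set.finite_range J)
  exact sum_eigenvalue_le not_finiteDimensional_ell2 (isPositive_centredSecondMoment hZ hρ hφ)
    (Submodule.span ℝ (Set.range J)) hr
    (fun N v hv hvJ => sum_inner_centredSecondMoment_le hZ hρ hφ hv hvJ) N

theorem summable_eigenvalue {ρ : Measure (EuclideanSpace ℝ (Fin d))} [IsFiniteMeasure ρ]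
    (hZ : IsCompact Z) (hρ : ∀ᵐ x ∂ρ, x ∈ Z) (hφ : ContinuousOn φ Z) :
    Summable fun i => eigenvalue (centredSecondMoment φ z ρ) i := by
  -- With `J = 0` and `r = 0` the remainder is `φ x - φ z`, so the tail bound becomes a bound on the
  -- whole trace.
  refine summable_of_sum_range_le (c := ∫ x, ‖linearRemainder φ z (fun _ => 0) x‖ ^ 2 ∂ρ)
    (eigenvalue_nonneg (isPositive_centredSecondMoment hZ hρ hφ)) fun N => ?_
  have h := sum_range_eigenvalue_le (z := z) hZ hρ hφ (fun _ => 0) (r := 0)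
    (by
      have h0 : Submodule.span ℝ (Set.range fun _ : Fin d => (0 : Ell2)) = ⊥ := by
        rw [Submodule.span_eq_bot]
        rintro _ ⟨_, rfl⟩
        rfl
      rw [h0, finrank_bot]) N
  simpa only [Nat.zero_add] using h

theorem tsum_eigenvalue_le {ρ : Measure (EuclideanSpace ℝ (Fin d))} [IsFiniteMeasure ρ]
    (hZ : IsCompact Z) (hρ : ∀ᵐ x ∂ρ, x ∈ Z) (hφ : ContinuousOn φ Z) (J : Fin d → Ell2) {r : ℕ}
    (hr : Module.finrank ℝ (Submodule.span ℝ (Set.range J)) ≤ r) :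
    ∑' i, eigenvalue (centredSecondMoment φ z ρ) (r + i)
      ≤ ∫ x, ‖linearRemainder φ z J x‖ ^ 2 ∂ρ :=
  Real.tsum_le_of_sum_range_le
    (fun _ => eigenvalue_nonneg (isPositive_centredSecondMoment hZ hρ hφ) _)
    (sum_range_eigenvalue_le hZ hρ hφ J hr)

theorem eigenvalue_isBigO (hε₀ : 0 < ε₀) (hZ : IsCompact Z)
    (hφ : ContinuousOn φ Z) (hprob : ∀ ε ∈ Set.Ioo 0 ε₀, IsProbabilityMeasure (ν ε))
    (hmem : ∀ ε ∈ Set.Ioo 0 ε₀, ∀ᵐ x ∂(ν ε), x ∈ Z)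
    (hcov : ∀ ε ∈ Set.Ioo 0 ε₀, ∀ i j, ∫ x, (x i - z i) * (x j - z j) ∂(ν ε) = ε * S i j)
    (hR : (fun ε : ℝ => ∫ x, ‖linearRemainder φ z J x‖ ^ 2 ∂(ν ε)) =o[𝓝[>] 0] fun ε : ℝ => ε)
    (i : ℕ) :
    (fun ε : ℝ => eigenvalue (centredSecondMoment φ z (ν ε)) i) =O[𝓝[>] 0] fun ε : ℝ => ε := by
  set K := (∑ i, ‖J i‖) ^ 2
  -- The factor 2 comes from `‖a + b‖² ≤ 2‖a‖² + 2‖b‖²`, and the 1 from `E‖R‖² ≤ ε`.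
  refine IsBigO.of_bound (2 * (K * S.trace + 1)) ?_
  filter_upwards [Ioo_mem_nhdsGT hε₀, isLittleO_iff.1 hR one_pos] with ε hε hεR
  have := hprob ε hε
  have hε0 : 0 < ε := hε.1
  have hpos := isPositive_centredSecondMoment (z := z) hZ (hmem ε hε) hφ
  have hRc := continuousOn_linearRemainder (z := z) (J := J) hφ
  rw [Real.norm_of_nonneg (eigenvalue_nonneg hpos i), Real.norm_of_nonneg hε0.le]
  rw [Real.norm_of_nonneg (integral_nonneg fun x => by positivity), Real.norm_of_nonneg hε0.le,
    one_mul] at hεR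
  have htr : ∫ x, ‖x - z‖ ^ 2 ∂(ν ε) = ε * S.trace := by
    rw [integral_norm_sub_sq (S := ε • S) hZ (hmem ε hε)
      (fun i j => by simpa using hcov ε hε i j), Matrix.trace_smul, smul_eq_mul]
  have hbound : ∀ x, ‖φ x - φ z‖ ^ 2
      ≤ 2 * K * ‖x - z‖ ^ 2 + 2 * ‖linearRemainder φ z J x‖ ^ 2 := by
    intro x
    have h1 : φ x - φ z = ∑ i, (x i - z i) • J i + linearRemainder φ z J x := by
      rw [linearRemainder, add_sub_cancel]
    have h2 : ‖∑ i, (x i - z i) • J i‖ ≤ (∑ i, ‖J i‖) * ‖x - z‖ := by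
      rw [Finset.sum_mul]
      refine norm_sum_le_of_le _ fun i _ => ?_
      rw [norm_smul, mul_comm]
      exact mul_le_mul_of_nonneg_left (by simpa using PiLp.norm_apply_le (x - z) i) (norm_nonneg _)
    have h3 := pow_le_pow_left₀ (norm_nonneg _) h2 2
    rw [mul_pow] at h3
    have h4 := pow_le_pow_left₀ (norm_nonneg _)
      (norm_add_le (∑ i, (x i - z i) • J i) (linearRemainder φ z J x)) 2
    rw [h1]
    nlinarith [sq_nonneg (‖∑ i, (x i - z i) • J i‖ - ‖linearRemainder φ z J x‖)]
  have hI1 : Integrable (fun x => ‖φ x - φ z‖ ^ 2) (ν ε) :=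
    integrable_of_continuousOn hZ (hmem ε hε) ((hφ.sub continuousOn_const).norm.pow 2)
  have hI2 : Integrable (fun x => 2 * K * ‖x - z‖ ^ 2) (ν ε) :=
    integrable_of_continuousOn hZ (hmem ε hε) (by fun_prop)
  have hI3 : Integrable (fun x => 2 * ‖linearRemainder φ z J x‖ ^ 2) (ν ε) :=
    integrable_of_continuousOn hZ (hmem ε hε) (continuousOn_const.mul (hRc.norm.pow 2))
  have hle := integral_mono hI1 (hI2.add hI3) hbound
  simp only [Pi.add_apply] at hle
  rw [integral_add hI2 hI3, integral_const_mul, integral_const_mul, htr] at hle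
  have hmain : eigenvalue (centredSecondMoment φ z (ν ε)) i ≤ ∫ x, ‖φ x - φ z‖ ^ 2 ∂(ν ε) := by
    refine eigenvalue_le (integral_nonneg fun x => by positivity) (fun v hv => ?_) i
    rw [inner_centredSecondMoment hZ (hmem ε hε) hφ]
    have hc : ContinuousOn (fun x => ⟪φ x - φ z, v⟫_ℝ) Z :=
      ContinuousOn.inner (𝕜 := ℝ) (hφ.sub continuousOn_const) continuousOn_const
    refine integral_mono (integrable_of_continuousOn hZ (hmem ε hε) (hc.mul hc)) hI1 fun x => ?_
    have h := abs_real_inner_le_norm (φ x - φ z) v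
    rw [hv, mul_one] at h
    have h' := mul_self_le_mul_self (abs_nonneg _) h
    rwa [abs_mul_abs_self, ← sq ‖_‖] at h'
  refine hmain.trans (hle.trans ?_)
  linarith

theorem isBigO_eigenvalue (hε₀ : 0 < ε₀) (hZ : IsCompact Z)
    (hφ : ContinuousOn φ Z) (hprob : ∀ ε ∈ Set.Ioo 0 ε₀, IsProbabilityMeasure (ν ε))
    (hmem : ∀ ε ∈ Set.Ioo 0 ε₀, ∀ᵐ x ∂(ν ε), x ∈ Z)
    (hcov : ∀ ε ∈ Set.Ioo 0 ε₀, ∀ i j, ∫ x, (x i - z i) * (x j - z j) ∂(ν ε) = ε * S i j)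
    (hR : (fun ε : ℝ => ∫ x, ‖linearRemainder φ z J x‖ ^ 2 ∂(ν ε)) =o[𝓝[>] 0] fun ε : ℝ => ε)
    (hS : S.PosDef) {i : ℕ} (hi : i < Module.finrank ℝ (Submodule.span ℝ (Set.range J))) :
    (fun ε : ℝ => ε) =O[𝓝[>] 0] fun ε : ℝ => eigenvalue (centredSecondMoment φ z (ν ε)) i := by
  obtain ⟨c, hc, hq⟩ := exists_pos_mul_norm_sq_le hS J
  have : FiniteDimensional ℝ (Submodule.span ℝ (Set.range J)) :=
    FiniteDimensional.span_of_finite ℝ (Set.finite_range J)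
  -- The linear part contributes at least `c/2 · ε` on the span, and the remainder removes at most
  -- `c/4 · ε`.
  refine IsBigO.of_bound (4 / c) ?_
  filter_upwards [Ioo_mem_nhdsGT hε₀, isLittleO_iff.1 hR (c := c / 4) (by positivity)]
    with ε hε hεR
  have := hprob ε hε
  have hε0 : 0 < ε := hε.1
  have hpos := isPositive_centredSecondMoment (z := z) hZ (hmem ε hε) hφ
  rw [Real.norm_of_nonneg (eigenvalue_nonneg hpos i), Real.norm_of_nonneg hε0.le]
  rw [Real.norm_of_nonneg (integral_nonneg fun x => by positivity),
    Real.norm_of_nonneg hε0.le] at hεR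
  have hmain : c / 4 * ε ≤ eigenvalue (centredSecondMoment φ z (ν ε)) i := by
    refine le_eigenvalue hpos (isCompactOperator_centredSecondMoment hZ (hmem ε hε) hφ)
      (by positivity) (Submodule.span ℝ (Set.range J)) (fun v hv => ?_) hi
    refine le_trans ?_ (le_inner_centredSecondMoment (J := J) hZ (hmem ε hε) hφ v)
    have h1 : ∫ x, ⟪∑ i, (x i - z i) • J i, v⟫_ℝ ^ 2 ∂(ν ε)
        = ε * ((fun i => ⟪J i, v⟫_ℝ) ⬝ᵥ S.mulVec fun i => ⟪J i, v⟫_ℝ) := by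
      simp only [sum_inner, real_inner_smul_left]
      rw [integral_inner_linear_sq (S := ε • S) hZ (hmem ε hε)
        (fun i j => by simpa using hcov ε hε i j), Matrix.smul_mulVec, dotProduct_smul,
        smul_eq_mul]
    rw [h1]
    have h2 := mul_le_mul_of_nonneg_left (hq v hv) hε0.le
    have h3 := mul_le_mul_of_nonneg_right hεR (sq_nonneg ‖v‖)
    linarith
  rw [div_mul_eq_mul_div, le_div_iff₀ hc]
  linarith

end Asymptotics

end LASE

/-! ### The main theorem -/

theorem mainTheorem4
    {d : ℕ} (hd : 1 ≤ d)
    (Z : Set (EuclideanSpace ℝ (Fin d)))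
    (μ : Measure (EuclideanSpace ℝ (Fin d)))
    (f : EuclideanSpace ℝ (Fin d) → EuclideanSpace ℝ (Fin d) → ℝ)
    (hmodel : LASE.IsLatentPositionModel Z μ f)
    (lam : ℕ → ℝ) (u : ℕ → EuclideanSpace ℝ (Fin d) → ℝ)
    (hmercer : LASE.IsMercerSystem Z μ f lam u)
    (zstar : EuclideanSpace ℝ (Fin d)) (hz : zstar ∈ interior Z)
    (hφ : LASE.mercerFeatureMap lam u zstar ≠ 0)
    (hf : LASE.HasLipschitzMixedDerivatives Z f)
    (ε₀ : ℝ) (hε₀ : 0 < ε₀)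
    (w : ℝ → EuclideanSpace ℝ (Fin d) → ℝ)
    (hw_cont : ∀ ε ∈ Set.Ioo 0 ε₀, ContinuousOn (w ε) Z)
    (hw_pos : ∀ ε ∈ Set.Ioo 0 ε₀, ∀ x ∈ Z, 0 < w ε x)
    (hw_norm : ∀ ε ∈ Set.Ioo 0 ε₀, ∫ x, w ε x ∂μ = 1)
    (Sig : Matrix (Fin d) (Fin d) ℝ) (hSig : Sig.rank = d)
    (hcov : ∀ ε ∈ Set.Ioo 0 ε₀, ∀ i j : Fin d,
      ∫ x, (x i - zstar i) * (x j - zstar j) ∂(LASE.weightedMeasure μ (w ε)) = ε * Sig i j)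
    (hmom₁ : (fun ε : ℝ => ∫ x, ‖x - zstar‖ ^ (5 / 2 : ℝ) ∂(LASE.weightedMeasure μ (w ε)))
      =o[𝓝[>] 0] fun ε : ℝ => ε)
    (hmom₂ : (fun ε : ℝ => ∫ x, ‖x - zstar‖ ^ (3 : ℝ) ∂(LASE.weightedMeasure μ (w ε)))
      =o[𝓝[>] 0] fun ε : ℝ => ε) :
    (∀ ε ∈ Set.Ioo 0 ε₀,
      Integrable (LASE.increment (LASE.mercerFeatureMap lam u) zstar)
        (LASE.weightedMeasure μ (w ε)) ∧
      Summable fun i : ℕ => LASE.eigenvalue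
        (LASE.centredSecondMoment (LASE.mercerFeatureMap lam u) zstar
          (LASE.weightedMeasure μ (w ε))) i) ∧
    (∀ i < LASE.localDim f zstar,
      (fun ε : ℝ => LASE.eigenvalue
        (LASE.centredSecondMoment (LASE.mercerFeatureMap lam u) zstar
          (LASE.weightedMeasure μ (w ε))) i) =Θ[𝓝[>] 0] fun ε : ℝ => ε) ∧
    (fun ε : ℝ => ∑' i : ℕ, LASE.eigenvalue
        (LASE.centredSecondMoment (LASE.mercerFeatureMap lam u) zstar
          (LASE.weightedMeasure μ (w ε))) (LASE.localDim f zstar + i))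
      =o[𝓝[>] 0] fun ε : ℝ => ε := by
  have hgramφ := LASE.inner_mercerFeatureMap hmodel hmercer
  set φ := LASE.mercerFeatureMap lam u
  have hZ := hmodel.isCompact
  have hφc : ContinuousOn φ Z := LASE.continuousOn_of_continuousOn_inner hgramφ hmodel.continuousOn
  have hprob : ∀ ε ∈ Set.Ioo 0 ε₀, IsProbabilityMeasure (LASE.weightedMeasure μ (w ε)) :=
    fun ε hε => LASE.isProbabilityMeasure_weightedMeasure hmodel.ae_mem (hw_pos ε hε)
      (hw_norm ε hε)
  have hmem : ∀ ε ∈ Set.Ioo 0 ε₀, ∀ᵐ x ∂(LASE.weightedMeasure μ (w ε)), x ∈ Z :=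
    fun ε _ => LASE.ae_mem_weightedMeasure hmodel.ae_mem
  obtain ⟨J, hgram, hJ⟩ := LASE.exists_partial_derivatives hf hgramφ hz
  have hrank : LASE.localDim f zstar = Module.finrank ℝ (Submodule.span ℝ (Set.range J)) := by
    rw [← LASE.rank_gram, LASE.localDim]
    congr 1
    ext i j
    rw [Matrix.gram_apply, hgram]
  have hPD : Sig.PosDef := by
    -- Any one admissible `ε` shows `Σ` to be positive semidefinite; full rank then makes it
    -- definite.
    have hmid : ε₀ / 2 ∈ Set.Ioo 0 ε₀ := ⟨by positivity, by linarith⟩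
    have := hprob _ hmid
    exact LASE.posDef_of_rank_eq
      (LASE.posSemidef_of_second_moment hZ (hmem _ hmid) hmid.1 (hcov _ hmid)) hSig
  have hR := LASE.integral_linearRemainder_isLittleO hε₀ hZ hφc hprob hmem hcov hmom₂ hJ
  refine ⟨fun ε hε => ?_, fun i hi => ⟨?_, ?_⟩, ?_⟩
  · have := hprob ε hε
    exact ⟨LASE.integrable_increment hZ (hmem ε hε) hφc,
      LASE.summable_eigenvalue hZ (hmem ε hε) hφc⟩
  · exact LASE.eigenvalue_isBigO hε₀ hZ hφc hprob hmem hcov hR i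
  · exact LASE.isBigO_eigenvalue hε₀ hZ hφc hprob hmem hcov hR hPD (hrank ▸ hi)
  · refine IsBigO.trans_isLittleO (IsBigO.of_bound 1 ?_) hR
    filter_upwards [Ioo_mem_nhdsGT hε₀] with ε hε
    have := hprob ε hε
    have hpos := LASE.isPositive_centredSecondMoment (z := zstar) hZ (hmem ε hε) hφc
    rw [one_mul, Real.norm_of_nonneg (tsum_nonneg fun i => LASE.eigenvalue_nonneg hpos _),
      Real.norm_of_nonneg (integral_nonneg fun x => by positivity)]
    exact LASE.tsum_eigenvalue_le hZ (hmem ε hε) hφc J hrank.ge
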